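/- Let $k$ be a field of characteristic zero, $n\ge 2$, and $R=k[x_0,\dots,x_n]$ with its standard grading. Let $f$ be the determinant of the $n\times n$ sub-Hankel matrix, whose $(i,j)$ entry ($0\le i,j\le n-1$) is $x_{i+j}$ if $i+j\le n$ and $0$ otherwise. Let $J=(\partial f/\partial x_0,\dots,\partial f/\partial x_n)\subset R$ be its gradient ideal and $J_{n-1}=(\partial f/\partial x_0,\dots,\partial f/\partial x_{n-1})$. Then: (1) There is an isomorphism of graded $R$-modules $J/J_{n-1}\cong \bigl(R/(x_n,x_{n-1}^{\,n-1})\bigr)(-(n-1))$. (2) The module $J/J_{n-1}$ has a minimal graded free resolution $$\mathcal C:\quad 0\to R(-(2n-1))\to R(-n)\oplus R(-2(n-1))\to R(-(n-1)),$$ the module $R/J_{n-1}$ has a minimal graded free resolution $$\mathcal J_{n-1}:\quad 0\to R(-n)^{n-1}\to R(-(n-1))^n\to R,$$ and the inclusion $J/J_{n-1}\subset R/J_{n-1}$ lifts to a graded chain map $\mathcal C\to\mathcal J_{n-1}$ whose mapping cone, augmented by the composite $R\to R/J_{n-1}\to R/J$, is the minimal graded free resolution of $R/J$. It has the form $$0\to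 R(-(2n-1))\to R(-n)^n\oplus R(-2(n-1))\xrightarrow{\ \phi\ } R(-(n-1))^{n+1}\to R.$$ (3) $J$ has maximal linear rank: the linear part of $\phi$, that is, its restriction to the free summand generated in degree $n$, has the same rank as $\phi$, and this rank is $n$. (4) If $n\ge 3$, then $R/J$ is strictly almost Cohen--Macaulay, that is, $\operatorname{depth} R/J=\dim R/J-1$, where the depth is taken with respect to $(x_0,\dots,x_n)$. (For $n=2$, $J=(x_0,x_1,x_2)$ and $R/J=k$ is Cohen--Macaulay.) -/

import Mathlib

noncomputable section

open MvPolynomial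

namespace SubHankel

/-! ### Gradings -/

section Gradings

variable {k : Type*} [Field k] {σ : Type*}

/-- The grading of the shifted module `M(-a)`: its component of degree `j` is `M_{j-a}`. -/
def shiftGrading {M : Type*} [AddCommGroup M] [Module k M] (ℳ : ℕ → Submodule k M) (a : ℕ) :
    ℕ → Submodule k M :=
  fun j => if a ≤ j then ℳ (j - a) else ⊥

/-- The grading of the free module `⨁ i, R(-t i)` over `R = k[σ]`. -/
def freeGrading {ι : Type*} (t : ι → ℕ) : ℕ → Submodule k (ι → MvPolynomial σ k) :=
  fun j => Submodule.pi Set.univ fun i => shiftGrading (homogeneousSubmodule σ k) (t i) j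

/-- The grading induced on `R ⧸ I` (for a homogeneous ideal `I`) by the standard grading of the
polynomial ring `R = k[σ]`. -/
def quotientGrading (I : Ideal (MvPolynomial σ k)) : ℕ → Submodule k (MvPolynomial σ k ⧸ I) :=
  fun j => (homogeneousSubmodule σ k j).map (Ideal.Quotient.mkₐ k I).toLinearMap

/-- The grading induced on a (homogeneous) submodule of `R ⧸ I`. -/
def submoduleGrading {I : Ideal (MvPolynomial σ k)}
    (N : Submodule (MvPolynomial σ k) (MvPolynomial σ k ⧸ I)) : ℕ → Submodule k N :=
  fun j => (quotientGrading I j).comap (N.subtype.restrictScalars k)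

/-- The subquotient `I / I'` of `R`, for ideals `I' ⊆ I`, realised as the image of `I` in
`R ⧸ I'`. -/
def idealQuotient (I' I : Ideal (MvPolynomial σ k)) :
    Submodule (MvPolynomial σ k) (MvPolynomial σ k ⧸ I') :=
  Submodule.map (Submodule.mkQ I') I

/-- The homogeneous maximal ideal of `R = k[σ]`. -/
def irrelevantIdeal (σ k : Type*) [Field k] : Ideal (MvPolynomial σ k) :=
  Ideal.span (Set.range X)

end Gradings

/-! ### Graded free complexes and minimal graded free resolutions -/

/-- A complex `⋯ → F₂ → F₁ → F₀` of finitely generated graded free modules over `R = k[σ]`, with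
`F i = ⨁ a : ι i, R(-twist i a)` and homogeneous differentials `d i : F (i+1) → F i` of degree
zero. -/
structure GradedFreeComplex (k : Type*) [Field k] (σ : Type*) where
  ι : ℕ → Type
  finite : ∀ i, Fintype (ι i)
  twist : ∀ i, ι i → ℕ
  d : ∀ i, (ι (i + 1) → MvPolynomial σ k) →ₗ[MvPolynomial σ k] (ι i → MvPolynomial σ k)
  d_graded : ∀ i j, ∀ v ∈ freeGrading (k := k) (σ := σ) (twist (i + 1)) j,
    d i v ∈ freeGrading (k := k) (σ := σ) (twist i) j
  d_comp_d : ∀ i v, d i (d (i + 1) v) = 0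

namespace GradedFreeComplex

variable {k : Type*} [Field k] {σ : Type*}

/-- The multiset of the `t` such that `F i = ⨁ t, R(-t)`. -/
def twists (F : GradedFreeComplex k σ) (i : ℕ) : Multiset ℕ :=
  ((F.finite i).elems : Finset (F.ι i)).val.map (F.twist i)

/-- `F` is, through the augmentation `ε : F 0 → M`, a minimal graded free resolution of the
graded module `M = ⨁ j, ℳ j`. -/
structure IsMinimalResolution (F : GradedFreeComplex k σ) {M : Type*} [AddCommGroup M]
    [Module k M] [Module (MvPolynomial σ k) M] (ℳ : ℕ → Submodule k M)
    (ε : (F.ι 0 → MvPolynomial σ k) →ₗ[MvPolynomial σ k] M) : Prop where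
  aug_graded : ∀ j, ∀ v ∈ freeGrading (k := k) (σ := σ) (F.twist 0) j, ε v ∈ ℳ j
  aug_surjective : Function.Surjective ε
  exact_zero : Function.Exact (F.d 0) ε
  exact_succ : ∀ i, Function.Exact (F.d (i + 1)) (F.d i)
  minimal : ∀ i v a, F.d i v a ∈ irrelevantIdeal σ k

/-- When `F` resolves `R ⧸ I` with `F 1 = R(-s)^r`, the second differential `φ : F 2 → F 1`
presents `I`; this is its linear part, the image under `φ` of the summand `R(-(s+1))^ℓ`
of `F 2`. -/
def linearPart (F : GradedFreeComplex k σ) (s : ℕ) :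
    Submodule (MvPolynomial σ k) (F.ι 1 → MvPolynomial σ k) :=
  Submodule.map (F.d 1) (Submodule.pi {a | F.twist 2 a ≠ s + 1} fun _ => ⊥)

/-- The linear rank of the presentation `F 2 → F 1 = R(-s)^r`. -/
def linearRank (F : GradedFreeComplex k σ) (s : ℕ) : ℕ :=
  Module.finrank (MvPolynomial σ k) (F.linearPart s)

/-- The rank of the presentation map `F 2 → F 1`. -/
def presentationRank (F : GradedFreeComplex k σ) : ℕ :=
  Module.finrank (MvPolynomial σ k) (LinearMap.range (F.d 1))

/-- Morphisms of graded free complexes: chain maps that are homogeneous of degree zero. -/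
structure Hom (C F : GradedFreeComplex k σ) where
  f : ∀ i, (C.ι i → MvPolynomial σ k) →ₗ[MvPolynomial σ k] (F.ι i → MvPolynomial σ k)
  f_graded : ∀ i j, ∀ v ∈ freeGrading (k := k) (σ := σ) (C.twist i) j,
    f i v ∈ freeGrading (k := k) (σ := σ) (F.twist i) j
  comm : ∀ i v, F.d i (f (i + 1) v) = f i (C.d i v)

namespace Hom

variable {C F : GradedFreeComplex k σ}

/-- Basis of the mapping cone, whose term in degree `i` is `F i ⊕ C (i-1)`. -/
def coneι (C F : GradedFreeComplex k σ) : ℕ → Type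
  | 0 => F.ι 0
  | i + 1 => F.ι (i + 1) ⊕ C.ι i

/-- Twists of the mapping cone. -/
def coneTwist (C F : GradedFreeComplex k σ) : ∀ i, coneι C F i → ℕ
  | 0 => F.twist 0
  | i + 1 => Sum.elim (F.twist (i + 1)) (C.twist i)

/-- Differential of the mapping cone: `(a, c) ↦ (d a + g c, - d c)`, the second coordinate being
absent in degree zero. -/
def coneD (g : Hom C F) : ∀ i, (coneι C F (i + 1) → MvPolynomial σ k) →ₗ[MvPolynomial σ k]
    (coneι C F i → MvPolynomial σ k)
  | 0 => F.d 0 ∘ₗ LinearMap.funLeft _ _ Sum.inl + g.f 0 ∘ₗ LinearMap.funLeft _ _ Sum.inr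
  | i + 1 =>
    (LinearEquiv.sumArrowLequivProdArrow (F.ι (i + 1)) (C.ι i) (MvPolynomial σ k)
        (MvPolynomial σ k)).symm.toLinearMap ∘ₗ
      LinearMap.prod
        (F.d (i + 1) ∘ₗ LinearMap.funLeft _ _ Sum.inl +
          g.f (i + 1) ∘ₗ LinearMap.funLeft _ _ Sum.inr)
        (-(C.d i ∘ₗ LinearMap.funLeft _ _ Sum.inr))

theorem mem_freeGrading {ι : Type*} {t : ι → ℕ} {j : ℕ} {v : ι → MvPolynomial σ k} :
    v ∈ freeGrading t j ↔ ∀ i, v i ∈ shiftGrading (homogeneousSubmodule σ k) (t i) j := by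
  simp [freeGrading, Submodule.mem_pi]

/-- The mapping cone of a morphism of graded free complexes. -/
def cone (g : Hom C F) : GradedFreeComplex k σ where
  ι := coneι C F
  finite
    | 0 => F.finite 0
    | i + 1 => @instFintypeSum _ _ (F.finite (i + 1)) (C.finite i)
  twist := coneTwist C F
  d := coneD g
  d_graded := by
    intro i j v hv
    rw [mem_freeGrading] at hv
    have hl : (fun a => v (Sum.inl a)) ∈ freeGrading (F.twist (i + 1)) j :=
      mem_freeGrading.2 fun a => hv (Sum.inl a)
    have hr : (fun a => v (Sum.inr a)) ∈ freeGrading (C.twist i) j :=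
      mem_freeGrading.2 fun a => hv (Sum.inr a)
    cases i with
    | zero => exact add_mem (F.d_graded _ _ _ hl) (g.f_graded _ _ _ hr)
    | succ i =>
      rw [mem_freeGrading]
      rintro (a | a)
      · exact mem_freeGrading.1 (add_mem (F.d_graded _ _ _ hl) (g.f_graded _ _ _ hr)) a
      · exact mem_freeGrading.1 (neg_mem (C.d_graded _ _ _ hr)) a
  d_comp_d := by
    intro i v
    have key : F.d i (F.d (i + 1) (fun a => v (Sum.inl a)) + g.f (i + 1) (fun a => v (Sum.inr a)))
        + g.f i (-(C.d i (fun a => v (Sum.inr a)))) = 0 := by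
      rw [map_add, F.d_comp_d, g.comm, map_neg]
      abel
    cases i with
    | zero => exact key
    | succ i =>
      funext b
      rcases b with a | a
      · exact congrFun key a
      · have h2 : -(C.d i (-(C.d (i + 1) (fun a => v (Sum.inr a))))) = 0 := by
          rw [map_neg, C.d_comp_d, neg_zero, neg_zero]
        exact congrFun h2 a

end Hom

end GradedFreeComplex

/-! ### Depth and the almost Cohen–Macaulay property -/

section Depth

variable {k : Type*} [Field k] {σ : Type*}

/-- The depth of a module over `R = k[σ]`: the supremum of the lengths of the `M`-regular
sequences in the homogeneous maximal ideal. -/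
def depth (σ k : Type*) [Field k] (M : Type*) [AddCommGroup M] [Module (MvPolynomial σ k) M] :
    ℕ∞ :=
  ⨆ rs ∈ {rs : List (MvPolynomial σ k) |
    (∀ r ∈ rs, r ∈ irrelevantIdeal σ k) ∧ RingTheory.Sequence.IsRegular M rs}, (rs.length : ℕ∞)

/-- `R ⧸ I` is strictly almost Cohen–Macaulay: its depth is exactly one less than its
dimension. -/
def IsStrictlyAlmostCohenMacaulay (I : Ideal (MvPolynomial σ k)) : Prop :=
  ringKrullDim (MvPolynomial σ k ⧸ I) = (depth σ k (MvPolynomial σ k ⧸ I) : WithBot ℕ∞) + 1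

end Depth

/-! ### The sub-Hankel determinant -/

section SubHankelDet

variable (k : Type*) [Field k] (n : ℕ)

/-- The generic sub-Hankel matrix of order `n` on `x_0, …, x_n`: the entry in row `i` and column
`j` (counted from `0`) is `x_{i+j}` if `i + j ≤ n`, and `0` otherwise. -/
def subHankelMatrix : Matrix (Fin n) (Fin n) (MvPolynomial (Fin (n + 1)) k) :=
  Matrix.of fun i j => if h : (i : ℕ) + j ≤ n then X ⟨i + j, Nat.lt_succ_of_le h⟩ else 0

/-- The sub-Hankel determinant. -/
def subHankelDet : MvPolynomial (Fin (n + 1)) k := (subHankelMatrix k n).det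

/-- The gradient ideal `J` of the sub-Hankel determinant. -/
def gradientIdeal : Ideal (MvPolynomial (Fin (n + 1)) k) :=
  Ideal.span (Set.range fun i : Fin (n + 1) => pderiv i (subHankelDet k n))

/-- The ideal `J_{n-1}` generated by the partial derivatives with respect to
`x_0, …, x_{n-1}`. -/
def subgradientIdeal : Ideal (MvPolynomial (Fin (n + 1)) k) :=
  Ideal.span (Set.range fun i : Fin n => pderiv i.castSucc (subHankelDet k n))

theorem subgradientIdeal_le : subgradientIdeal k n ≤ gradientIdeal k n := by
  refine Ideal.span_mono ?_
  rintro _ ⟨i, rfl⟩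
  exact ⟨i.castSucc, rfl⟩

/-- The quotient `J / J_{n-1}`. -/
abbrev gradientQuotient : Submodule (MvPolynomial (Fin (n + 1)) k)
    (MvPolynomial (Fin (n + 1)) k ⧸ subgradientIdeal k n) :=
  idealQuotient (subgradientIdeal k n) (gradientIdeal k n)

/-- The ideal `(x_n, x_{n-1}^{n-1})`. -/
def tailIdeal : Ideal (MvPolynomial (Fin (n + 1)) k) :=
  Ideal.span {X (Fin.last n), X ⟨n - 1, Nat.lt_succ_of_le (Nat.sub_le n 1)⟩ ^ (n - 1)}

/-- The canonical projection `R ⧸ J_{n-1} → R ⧸ J`. -/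
def projection : (MvPolynomial (Fin (n + 1)) k ⧸ subgradientIdeal k n)
    →ₗ[MvPolynomial (Fin (n + 1)) k] (MvPolynomial (Fin (n + 1)) k ⧸ gradientIdeal k n) :=
  Submodule.factor (subgradientIdeal_le k n)

end SubHankelDet

end SubHankel

end

/-! Put `b = -x_n` and `a i = x_{n-i}`. Reversing the columns turns the sub-Hankel matrix into a
Toeplitz Hessenberg matrix, so up to sign `f` is the `n`-th coefficient of `D = 1/(1-K)`, where `K =
∑ b^r a_{r+1} t^{r+1}`. Every derivation satisfies `δD = D² δK`, so the partials are governed by the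
coefficients `q_m` of `Q = D²`: up to sign, `∂f/∂x_p` is `Y_p = b^(n-1-p) q_p` for `p < n`, and
`∂f/∂x_n` is a combination `G` of such terms of order `n-1`. The equation `(1-K)Q' = 2K'Q` gives a
recurrence for `q_m` (`succ_mul_hessenbergSq`); multiplied by powers of `b` it becomes `n-1` linear
syzygies of the `Y_p`. Characteristic zero enters through the invertibility of positive integers.

Let `I_N` be the ideal of the `Y_p` of order `N`. Then `I_{N+1} = b I_N + (q_N)`, with `q_N ∈ I_N`
for `N ≥ 1` and `q_N ≡ (N+1) a_1^N` modulo `b`. Since `b, a_1` is a regular sequence, induction on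
`N` shows that the linear syzygies form a basis of all syzygies (`exists_eq_sum_linearSyzygy`,
`eq_zero_of_sum_linearSyzygy`), which resolves `R/J_{n-1}`, and that `I_{m+2} : b^m = (b, a_1)`.
Modulo `I_n`, the recurrence trades a factor `a_1` for a drop in index; hence `a_1^(n-1) G`
vanishes, while `a_1^(n-2) G` is a unit times `a_2^(n-1) b^(n-2)`. As `a_2` is regular modulo `(b,
a_1)`, this yields `I_n : G = (b, a_1^(n-1))` (`mem_span_of_mul_lastPartial_mem`). So `J/J_{n-1}`,
generated by `G`, is the shifted complete intersection of (1), resolved by a Koszul complex.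
Multiplication by `G` lifts to a chain map, and its cone is minimal because the twists strictly
increase.

The presentation rank is at most `n` because the partials are not all zero; the `n-1` linear
syzygies and the Koszul column of `x_n` are `n` independent columns of degree `n`.

For `n ≥ 3` the radical of `J` is `(b, a_1)`, so the dimension is `n-1`. Modulo `J` the element `(b
a_2)^(n-2)` has annihilator `(x_n, x_{n-1}, x_{n-2})` (`mul_socle_mem_iff`), an associated prime of
dimension `n-2`, which bounds the depth. Conversely `x_0, …, x_{n-3}` is a regular sequence: killing
these variables leaves `b, a_1, a_2` untouched, so the syzygy computations still hold and syzygies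
lift (`inf_gradientIdeal_le`). -/

noncomputable section

open MvPolynomial

namespace SubHankel

/-! ### Hessenberg recurrences and linear syzygies -/

section HessenbergSequences

variable {S : Type*} [CommRing S] (b : S) (a : ℕ → S)

/-- The determinants of the Toeplitz Hessenberg matrices with diagonals `a 1, a 2, …` and
subdiagonal `-b`. -/
def hessenbergSeq : ℕ → S
  | 0 => 1
  | m + 1 => ∑ r : Fin (m + 1), b ^ (r : ℕ) * a (r + 1) * hessenbergSeq (m - r)

/-- The Cauchy square of `hessenbergSeq`. -/
def hessenbergSq (m : ℕ) : S :=
  ∑ p ∈ Finset.HasAntidiagonal.antidiagonal m, hessenbergSeq b a p.1 * hessenbergSeq b a p.2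

theorem hessenbergSeq_zero : hessenbergSeq b a 0 = 1 := by
  simp [hessenbergSeq]

theorem hessenbergSeq_succ (m : ℕ) : hessenbergSeq b a (m + 1) =
    ∑ r ∈ Finset.range (m + 1), b ^ r * a (r + 1) * hessenbergSeq b a (m - r) := by
  rw [hessenbergSeq, Finset.sum_range fun r => b ^ r * a (r + 1) * hessenbergSeq b a (m - r)]

theorem hessenbergSq_zero : hessenbergSq b a 0 = 1 := by
  simp [hessenbergSq, hessenbergSeq_zero]

/-- The power series `∑ b ^ r * a (r + 1) * t ^ (r + 1)`. -/
def symbolSeries : PowerSeries S :=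
  PowerSeries.X * PowerSeries.mk fun r => b ^ r * a (r + 1)

/-- This is `D = 1/(1-K)`, stated without inverting `1-K`. -/
theorem mk_hessenbergSeq : PowerSeries.mk (hessenbergSeq b a) =
    1 + symbolSeries b a * PowerSeries.mk (hessenbergSeq b a) := by
  ext m
  rw [symbolSeries, mul_assoc]
  cases m with
  | zero => simp [hessenbergSeq_zero]
  | succ m =>
    rw [map_add, PowerSeries.coeff_succ_X_mul, PowerSeries.coeff_mul,
      Finset.Nat.sum_antidiagonal_eq_sum_range_succ_mk, PowerSeries.coeff_mk, hessenbergSeq_succ]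
    simp [PowerSeries.coeff_one]

theorem mk_hessenbergSq : PowerSeries.mk (hessenbergSq b a) =
    PowerSeries.mk (hessenbergSeq b a) * PowerSeries.mk (hessenbergSeq b a) := by
  ext m
  simp [PowerSeries.coeff_mul, hessenbergSq]

/-- The recurrence for the Cauchy square coming from its differential equation. -/
theorem succ_mul_hessenbergSq (m : ℕ) : ((m + 1 : ℕ) : S) * hessenbergSq b a (m + 1) =
    ∑ r ∈ Finset.range (m + 1), ((m + r + 2 : ℕ) : S) * (b ^ r * a (r + 1)) *
      hessenbergSq b a (m - r) := by
  set D := PowerSeries.mk (hessenbergSeq b a) with hD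
  set K := symbolSeries b a with hK
  set Q := PowerSeries.mk (hessenbergSq b a) with hQ
  set A := PowerSeries.mk fun r => b ^ r * a (r + 1) with hA
  have h1 : D = 1 + K * D := mk_hessenbergSeq b a
  have hQD : Q = D * D := mk_hessenbergSq b a
  let δ := PowerSeries.derivative S
  have h2 : δ D = K * δ D + δ K * D := by
    conv_lhs => rw [h1]
    simp [δ, Derivation.leibniz]
    ring
  have h3 : δ Q = 2 * (D * δ D) := by
    rw [hQD, Derivation.leibniz]; simp; ring
  -- The differential equation `(1-K) Q' = 2 K' Q` of `Q = (1-K)^(-2)`. Passing to `t d/dt` below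
  -- makes the operator diagonal on coefficients.
  have h5 : δ Q = K * δ Q + 2 * δ K * Q := by
    rw [h3, hQD]
    linear_combination 2 * D * h2
  have h6 : PowerSeries.X * δ Q = PowerSeries.X * (A * (PowerSeries.X * δ Q)) +
      2 * (PowerSeries.X * ((A + PowerSeries.X * δ A) * Q)) := by
    have hKA : K = PowerSeries.X * A := rfl
    have h7 : δ K = A + PowerSeries.X * δ A := by
      rw [hKA, Derivation.leibniz]
      simp [δ, PowerSeries.derivative_X]
      ring
    rw [h7, hKA] at h5
    linear_combination PowerSeries.X * h5
  have hX : ∀ (B : PowerSeries S) (j : ℕ), PowerSeries.coeff j (PowerSeries.X * δ B) =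
      (j : S) * PowerSeries.coeff j B := by
    intro B j
    cases j with
    | zero => simp
    | succ j =>
      rw [PowerSeries.coeff_succ_X_mul]
      simp [δ, PowerSeries.coeff_derivative]
      ring
  have h8 := congrArg (PowerSeries.coeff (m + 1)) h6
  rw [hX, map_add, PowerSeries.coeff_succ_X_mul, ← map_ofNat (PowerSeries.C (R := S)) 2,
    PowerSeries.coeff_C_mul, PowerSeries.coeff_succ_X_mul, PowerSeries.coeff_mul,
    PowerSeries.coeff_mul,
    Finset.Nat.sum_antidiagonal_eq_sum_range_succ_mk,
    Finset.Nat.sum_antidiagonal_eq_sum_range_succ_mk] at h8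
  simp only [map_add, hX] at h8
  simp only [hQ, hA, PowerSeries.coeff_mk] at h8
  rw [h8, Finset.mul_sum, ← Finset.sum_add_distrib]
  refine Finset.sum_congr rfl fun r hr => ?_
  have : ((m - r : ℕ) : S) = m - r := Nat.cast_sub (by simp at hr; omega)
  rw [this]
  push_cast
  ring

/-- The `p`-th partial derivative `∂/∂x_p` of the sub-Hankel determinant of order `N`, up to sign,
for `p < N`. -/
def tailPartial (N p : ℕ) : S := b ^ (N - 1 - p) * hessenbergSq b a p

/-- The last partial derivative `∂/∂x_N` of the sub-Hankel determinant of order `N = m + 1`, up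
to sign. -/
def lastPartial (m : ℕ) : S :=
  ∑ r ∈ Finset.range m, ((r + 1 : ℕ) : S) * a (r + 2) * tailPartial b a m (m - 1 - r)

/-- The linear syzygies of the `tailPartial`s. -/
def linearSyzygy (m p : ℕ) : S :=
  if p = m then -(m : S) * b else if p < m then ((2 * m - p : ℕ) : S) * a (m - p) else 0

/-- The recurrence for the Cauchy square times `b ^ (N - (m + 1))`: each `b ^ r` in it is absorbed
into the partial of index `m - r`. The right side has order `N`, the left side order `N + 1`; this
change of order drives all later inductions. -/
theorem succ_mul_tailPartial {N m : ℕ} (h : m + 1 ≤ N) :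
    ((m + 1 : ℕ) : S) * tailPartial b a (N + 1) (m + 1) =
    ∑ r ∈ Finset.range (m + 1), ((m + r + 2 : ℕ) : S) * a (r + 1) * tailPartial b a N (m - r) := by
  rw [tailPartial, mul_left_comm, succ_mul_hessenbergSq, Finset.mul_sum]
  refine Finset.sum_congr rfl fun r hr => ?_
  have hr' : r ≤ m := by simp at hr; omega
  rw [tailPartial, show N - 1 - (m - r) = (N + 1 - 1 - (m + 1)) + r by omega, pow_add]
  ring

theorem mul_tailPartial {N p : ℕ} (h : p < N) :
    b * tailPartial b a N p = tailPartial b a (N + 1) p := by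
  rw [tailPartial, tailPartial, show N + 1 - 1 - p = (N - 1 - p) + 1 by omega, pow_succ]
  ring

/-- One more factor `b` raises the order on the right of `succ_mul_tailPartial`, so both sides
involve partials of the same order. -/
theorem sum_linearSyzygy_eq_zero {N m : ℕ} (h : m + 1 < N) :
    ∑ p ∈ Finset.range N, linearSyzygy b a (m + 1) p * tailPartial b a N p = 0 := by
  obtain ⟨N, rfl⟩ : ∃ M, N = M + 1 := ⟨N - 1, by omega⟩
  have h0 : ∑ p ∈ Finset.range (N + 1), linearSyzygy b a (m + 1) p * tailPartial b a (N + 1) p =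
      ∑ p ∈ Finset.range (m + 2), linearSyzygy b a (m + 1) p * tailPartial b a (N + 1) p := by
    symm
    apply Finset.sum_subset
    · intro p; simp; omega
    · intro p _ hp
      simp at hp
      rw [linearSyzygy, if_neg (by omega), if_neg (by omega), zero_mul]
  have h1 := congrArg (b * ·) (succ_mul_tailPartial b a (N := N) (m := m) (by omega))
  simp only [Finset.mul_sum] at h1
  rw [h0, Finset.sum_range_succ, ← Finset.sum_range_reflect]
  have h2 : ∑ j ∈ Finset.range (m + 1), linearSyzygy b a (m + 1) (m + 1 - 1 - j) *
        tailPartial b a (N + 1) (m + 1 - 1 - j) =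
      ∑ r ∈ Finset.range (m + 1), b * (((m + r + 2 : ℕ) : S) * a (r + 1) *
        tailPartial b a N (m - r)) := by
    refine Finset.sum_congr rfl fun r hr => ?_
    have hr' : r ≤ m := by simp at hr; omega
    rw [linearSyzygy, if_neg (by omega), if_pos (by omega), Nat.add_sub_cancel,
      ← mul_tailPartial b a (by omega), show 2 * (m + 1) - (m - r) = m + r + 2 by omega,
      show m + 1 - (m - r) = r + 1 by omega]
    ring
  rw [h2, ← h1, linearSyzygy, if_pos rfl]
  ring

/-- Compatibility with ring maps serves the depth argument, where the first variables are set to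
zero. -/
theorem map_hessenbergSeq {T : Type*} [CommRing T] (f : S →+* T) (m : ℕ) :
    f (hessenbergSeq b a m) = hessenbergSeq (f b) (fun i => f (a i)) m := by
  induction m using Nat.strong_induction_on with
  | _ m ih =>
    cases m with
    | zero => simp [hessenbergSeq_zero]
    | succ m =>
      rw [hessenbergSeq_succ, hessenbergSeq_succ, map_sum]
      refine Finset.sum_congr rfl fun r _ => ?_
      rw [map_mul, map_mul, map_pow, ih _ (by omega)]

theorem map_tailPartial {T : Type*} [CommRing T] (f : S →+* T) (N p : ℕ) :
    f (tailPartial b a N p) = tailPartial (f b) (fun i => f (a i)) N p := by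
  simp [tailPartial, hessenbergSq, map_hessenbergSeq]

theorem map_lastPartial {T : Type*} [CommRing T] (f : S →+* T) (m : ℕ) :
    f (lastPartial b a m) = lastPartial (f b) (fun i => f (a i)) m := by
  simp [lastPartial, map_tailPartial]

theorem map_linearSyzygy {T : Type*} [CommRing T] (f : S →+* T) (m p : ℕ) :
    f (linearSyzygy b a m p) = linearSyzygy (f b) (fun i => f (a i)) m p := by
  unfold linearSyzygy
  split_ifs <;> simp

end HessenbergSequences

/-! ### Colon ideals of the partials over a regular sequence `b, a 1, a 2` -/

section RegularTriple

variable {S : Type*} [CommRing S] {b : S} {a : ℕ → S}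

variable (b a) in
/-- The ideal generated by the `tailPartial`s. -/
def tailPartialIdeal (N : ℕ) : Ideal S :=
  Ideal.span (Set.range fun p : Fin N => tailPartial b a N p)

theorem tailPartial_mem {N p : ℕ} (h : p < N) : tailPartial b a N p ∈ tailPartialIdeal b a N :=
  Ideal.subset_span ⟨⟨p, h⟩, rfl⟩

theorem mem_tailPartialIdeal {N : ℕ} {x : S} : x ∈ tailPartialIdeal b a N ↔
    ∃ c : ℕ → S, x = ∑ p ∈ Finset.range N, c p * tailPartial b a N p := by
  rw [tailPartialIdeal, Ideal.mem_span_range_iff_exists_fun]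
  constructor
  · rintro ⟨c, rfl⟩
    refine ⟨fun p => if h : p < N then c ⟨p, h⟩ else 0, ?_⟩
    rw [Finset.sum_range]
    simp
  · rintro ⟨c, rfl⟩
    exact ⟨fun p => c p, by rw [Finset.sum_range]⟩

theorem mul_lastPartial_mem (m : ℕ) : b * lastPartial b a m ∈ tailPartialIdeal b a (m + 1) := by
  rw [lastPartial, Finset.mul_sum]
  refine Ideal.sum_mem _ fun r hr => ?_
  have hr' : r < m := by simpa using hr
  rw [mul_left_comm, mul_tailPartial b a (by omega)]
  exact Ideal.mul_mem_left _ _ (tailPartial_mem (by omega))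

theorem hessenbergSq_mem_span (m : ℕ) (hu : ∀ j : ℕ, IsUnit ((j + 1 : ℕ) : S)) :
    hessenbergSq b a (m + 1) ∈ Ideal.span {b, a 1} := by
  rw [← (Ideal.unit_mul_mem_iff_mem _ (hu m)), succ_mul_hessenbergSq]
  refine Ideal.sum_mem _ fun r _ => ?_
  apply Ideal.mul_mem_right
  apply Ideal.mul_mem_left
  cases r with
  | zero => exact Ideal.mul_mem_left _ _ (Ideal.subset_span (by simp))
  | succ r =>
    exact Ideal.mul_mem_right _ _ (Ideal.pow_mem_of_mem _ (Ideal.subset_span (by simp)) _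
      (by omega))

theorem tailPartialIdeal_le {N : ℕ} (hN : 2 ≤ N) (hu : ∀ j : ℕ, IsUnit ((j + 1 : ℕ) : S)) :
    tailPartialIdeal b a N ≤ Ideal.span {b, a 1} := by
  rw [tailPartialIdeal, Ideal.span_le]
  rintro _ ⟨⟨p, hp⟩, rfl⟩
  cases p with
  | zero =>
    exact Ideal.mul_mem_right _ _ (Ideal.pow_mem_of_mem _ (Ideal.subset_span (by simp)) _
      (show 0 < N - 1 - 0 by omega))
  | succ p => exact Ideal.mul_mem_left _ _ (hessenbergSq_mem_span p hu)

/-- For `m = 1` the last partial is `a 2`; this is where `n = 2` behaves differently from `n ≥ 3`.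
-/
theorem lastPartial_mem {m : ℕ} (hm : 2 ≤ m) (hu : ∀ j : ℕ, IsUnit ((j + 1 : ℕ) : S)) :
    lastPartial b a m ∈ Ideal.span {b, a 1} := by
  refine Ideal.sum_mem _ fun r hr => Ideal.mul_mem_left _ _ (tailPartialIdeal_le hm hu ?_)
  exact tailPartial_mem (by simp at hr; omega)

/-- Modulo `b`, the `m`-th term of `hessenbergSq` is `(m + 1) * a 1 ^ m`. -/
theorem hessenbergSq_sub_mem (m : ℕ) (hu : ∀ j : ℕ, IsUnit ((j + 1 : ℕ) : S)) :
    hessenbergSq b a m - ((m + 1 : ℕ) : S) * a 1 ^ m ∈ Ideal.span {b} := by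
  induction m with
  | zero => simp [hessenbergSq_zero]
  | succ m ih =>
    rw [← (Ideal.unit_mul_mem_iff_mem _ (hu m)), mul_sub, succ_mul_hessenbergSq,
      Finset.sum_range_succ']
    have h1 : ∑ r ∈ Finset.range m, ((m + (r + 1) + 2 : ℕ) : S) * (b ^ (r + 1) * a (r + 1 + 1)) *
        hessenbergSq b a (m - (r + 1)) ∈ Ideal.span {b} := by
      refine Ideal.sum_mem _ fun r _ => ?_
      rw [pow_succ', Ideal.mem_span_singleton]
      exact ⟨((m + (r + 1) + 2 : ℕ) : S) * (b ^ r * a (r + 1 + 1)) *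
        hessenbergSq b a (m - (r + 1)), by ring⟩
    have h2 := Ideal.mul_mem_left _ (((m + 2 : ℕ) : S) * a 1) ih
    convert add_mem h1 h2 using 1
    simp
    ring

/-- The extreme case of `succ_mul_tailPartial`, in which the left side carries no power of `b`. -/
theorem hessenbergSq_mem {N : ℕ} (hN : 1 ≤ N) (hu : ∀ j : ℕ, IsUnit ((j + 1 : ℕ) : S)) :
    hessenbergSq b a N ∈ tailPartialIdeal b a N := by
  obtain ⟨N, rfl⟩ : ∃ M, N = M + 1 := ⟨N - 1, by omega⟩
  rw [← (Ideal.unit_mul_mem_iff_mem _ (hu N))]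
  have h := succ_mul_tailPartial b a (N := N + 1) (m := N) le_rfl
  rw [tailPartial, show N + 1 + 1 - 1 - (N + 1) = 0 by omega, pow_zero, one_mul] at h
  rw [h]
  refine Ideal.sum_mem _ fun r _ => Ideal.mul_mem_left _ _ (tailPartial_mem (by omega))

/-! Powers of `a 1` on the socle of `R ⧸ tailPartialIdeal`. -/

theorem sum_mul_tailPartial_mem {N m : ℕ} (h : m + 1 ≤ N) :
    ∑ r ∈ Finset.range (m + 1), ((m + r + 2 : ℕ) : S) * a (r + 1) * tailPartial b a N (m - r) ∈
      tailPartialIdeal b a (N + 1) := by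
  rw [← succ_mul_tailPartial b a h]
  exact Ideal.mul_mem_left _ _ (tailPartial_mem (by omega))

/-- Modulo the ideal of order `N + 1`, the recurrence expresses `(m + 2) * a 1` times the partial of
index `m` through partials of smaller index. Each factor `a 1` thus lowers the index, and `m + 1`
factors exhaust it. -/
theorem pow_mul_tailPartial_mem (hu : ∀ j : ℕ, IsUnit ((j + 1 : ℕ) : S)) {N m j : ℕ}
    (hm : m < N) (hj : m < j) : a 1 ^ j * tailPartial b a N m ∈ tailPartialIdeal b a (N + 1) := by
  induction m using Nat.strong_induction_on generalizing j with
  | _ m ih =>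
    obtain ⟨j, rfl⟩ : ∃ i, j = i + 1 := ⟨j - 1, by omega⟩
    have h := Ideal.mul_mem_left _ (a 1 ^ j) (sum_mul_tailPartial_mem (b := b) (a := a) hm)
    rw [Finset.sum_range_succ', mul_add, Ideal.add_mem_iff_right] at h
    · rw [← (Ideal.unit_mul_mem_iff_mem _ (hu (m + 1)))]
      convert h using 1
      simp
      ring
    · rw [Finset.mul_sum]
      refine Ideal.sum_mem _ fun r hr => ?_
      simp at hr
      rw [mul_left_comm]
      exact Ideal.mul_mem_left _ _ (ih (m - (r + 1)) (by omega) (by omega) (by omega))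

/-- With exactly `m` factors `a 1`, only the terms lowering the index by one at each step survive.
They satisfy `(m + 3) * a 1 * Y_{m+1} ≡ -(m + 4) * a 2 * Y_m`; the product of the ratios telescopes
to `(-1)^m (m + 3) / 3`, whence the factor `3`. -/
theorem pow_mul_tailPartial_sub_mem (hu : ∀ j : ℕ, IsUnit ((j + 1 : ℕ) : S)) {N m : ℕ}
    (hm : m < N) : 3 * (a 1 ^ m * tailPartial b a N m) -
      (-1) ^ m * ((m + 3 : ℕ) : S) * (a 2 ^ m * tailPartial b a N 0) ∈
      tailPartialIdeal b a (N + 1) := by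
  induction m with
  | zero => simp
  | succ m ih =>
    have h := Ideal.mul_mem_left _ (a 1 ^ m) (sum_mul_tailPartial_mem (b := b) (a := a) hm)
    rw [Finset.sum_range_succ', Finset.sum_range_succ', add_assoc, mul_add,
      Ideal.add_mem_iff_right] at h
    · rw [← (Ideal.unit_mul_mem_iff_mem _ (hu (m + 2)))]
      have h2 := sub_mem (Ideal.mul_mem_left _ 3 h)
        (Ideal.mul_mem_left _ (((m + 4 : ℕ) : S) * a 2) (ih (by omega)))
      convert h2 using 1
      simp
      ring
    · rw [Finset.mul_sum]
      refine Ideal.sum_mem _ fun r hr => ?_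
      simp at hr
      rw [mul_left_comm]
      exact Ideal.mul_mem_left _ _ (pow_mul_tailPartial_mem hu (by omega) (by omega))

/-- Only the top-index term `a 2 * Y_m` of the last partial survives multiplication by `a 1 ^ m`.
The result shows that `a 1 ^ m` does not yet annihilate the last partial. -/
theorem pow_mul_lastPartial_sub_mem (hu : ∀ j : ℕ, IsUnit ((j + 1 : ℕ) : S)) (m : ℕ) :
    3 * (a 1 ^ m * lastPartial b a (m + 1)) -
      (-1) ^ m * ((m + 3 : ℕ) : S) * (a 2 ^ (m + 1) * b ^ m) ∈
      tailPartialIdeal b a (m + 2) := by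
  have h1 := Ideal.mul_mem_left _ (a 2) (pow_mul_tailPartial_sub_mem (b := b) (a := a) hu
    (N := m + 1) (m := m) (by omega))
  have h2 : ∑ r ∈ Finset.range m, 3 * (a 1 ^ m * (((r + 1 + 1 : ℕ) : S) * a (r + 1 + 2) *
      tailPartial b a (m + 1) (m + 1 - 1 - (r + 1)))) ∈ tailPartialIdeal b a (m + 2) := by
    refine Ideal.sum_mem _ fun r hr => Ideal.mul_mem_left _ _ ?_
    simp at hr
    rw [mul_left_comm]
    exact Ideal.mul_mem_left _ _ (pow_mul_tailPartial_mem hu (by omega) (by omega))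
  rw [lastPartial, Finset.sum_range_succ']
  convert add_mem h1 h2 using 1
  rw [← Finset.mul_sum, ← Finset.mul_sum]
  simp [tailPartial, hessenbergSq_zero]
  ring

theorem pow_succ_mul_lastPartial_mem (hu : ∀ j : ℕ, IsUnit ((j + 1 : ℕ) : S)) (m : ℕ) :
    a 1 ^ m * lastPartial b a m ∈ tailPartialIdeal b a (m + 1) := by
  rw [lastPartial, Finset.mul_sum]
  refine Ideal.sum_mem _ fun r hr => ?_
  simp at hr
  rw [mul_left_comm]
  exact Ideal.mul_mem_left _ _ (pow_mul_tailPartial_mem hu (by omega) (by omega))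

/-! Consequences of regularity. -/

variable (h0 : ∀ x, b * x = 0 → x = 0) (h1 : ∀ x, a 1 * x ∈ Ideal.span {b} → x ∈ Ideal.span {b})
  (hu : ∀ j : ℕ, IsUnit ((j + 1 : ℕ) : S))

include h1 in
theorem pow_mul_mem_span (j : ℕ) {x : S} (hx : a 1 ^ j * x ∈ Ideal.span {b}) :
    x ∈ Ideal.span {b} := by
  induction j with
  | zero => simpa using hx
  | succ j ih =>
    apply ih
    apply h1
    rwa [← mul_assoc, ← pow_succ']

include h1 hu in
-- Modulo `b`, the `N`-th Cauchy square coefficient is a unit times `a 1 ^ N`, hence regular.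
theorem dvd_of_mul_hessenbergSq_mem {N : ℕ} {x : S} (hx : x * hessenbergSq b a N ∈ Ideal.span {b}) :
    ∃ y, x = b * y := by
  have h := sub_mem hx (Ideal.mul_mem_left _ x (hessenbergSq_sub_mem (b := b) (a := a) N hu))
  rw [← mul_sub, sub_sub_cancel, mul_left_comm, (Ideal.unit_mul_mem_iff_mem _ (hu N)),
    mul_comm] at h
  exact Ideal.mem_span_singleton.1 (pow_mul_mem_span h1 N h)

include h0 h1 hu in
/-- The syzygies of the `tailPartial`s are generated by the linear ones. -/
theorem exists_eq_sum_linearSyzygy {N : ℕ} (c : ℕ → S)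
    (hc : ∑ p ∈ Finset.range (N + 1), c p * tailPartial b a (N + 1) p = 0) :
    ∃ d : ℕ → S, ∀ p < N + 1, c p = ∑ q ∈ Finset.range N, d q * linearSyzygy b a (q + 1) p := by
  induction N generalizing c with
  | zero =>
    refine ⟨0, fun p hp => ?_⟩
    obtain rfl : p = 0 := by omega
    simpa [tailPartial, hessenbergSq_zero] using hc
  | succ N ih =>
    have hsplit : ∀ e : ℕ → S, ∑ p ∈ Finset.range (N + 1 + 1), e p * tailPartial b a (N + 1 + 1) p =
        b * ∑ p ∈ Finset.range (N + 1), e p * tailPartial b a (N + 1) p +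
          e (N + 1) * hessenbergSq b a (N + 1) := by
      intro e
      rw [Finset.sum_range_succ, Finset.mul_sum]
      congr 1
      · refine Finset.sum_congr rfl fun p hp => ?_
        rw [← mul_tailPartial b a (by simpa using hp)]
        ring
      · simp [tailPartial]
    obtain ⟨c', hc'⟩ : ∃ y, c (N + 1) = b * y := by
      apply dvd_of_mul_hessenbergSq_mem h1 hu (N := N + 1)
      rw [hsplit] at hc
      rw [eq_neg_of_add_eq_zero_right hc, Ideal.mem_span_singleton]
      exact (Dvd.intro _ rfl).neg_right
    obtain ⟨u, hu'⟩ := (hu N).exists_left_inv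
    -- The last entry of the syzygy of index `N + 1` is `-(N + 1) * b` and `u` inverts `N + 1`, so
    -- adding this multiple cancels the last coefficient `b * c'`. What remains is `b` times a
    -- relation of lower order, and `b` is regular.
    obtain ⟨d, hd⟩ := ih (fun p => c p + u * c' * linearSyzygy b a (N + 1) p) (by
      have h2 := sum_linearSyzygy_eq_zero b a (N := N + 1 + 1) (m := N) (by omega)
      have h3 : ∑ p ∈ Finset.range (N + 1 + 1), (c p + u * c' * linearSyzygy b a (N + 1) p) *
          tailPartial b a (N + 1 + 1) p = 0 := by
        simp only [add_mul, Finset.sum_add_distrib, mul_assoc]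
        rw [hc]
        simp only [← Finset.mul_sum]
        rw [h2]
        simp
      rw [hsplit] at h3
      apply h0
      rw [← h3, hc', linearSyzygy, if_pos rfl]
      linear_combination b * c' * hessenbergSq b a (N + 1) * hu')
    refine ⟨fun q => if q < N then d q else -(u * c'), fun p hp => ?_⟩
    simp only [Finset.sum_range_succ, lt_irrefl, if_false]
    have h4 : ∑ x ∈ Finset.range N, (if x < N then d x else -(u * c')) * linearSyzygy b a (x + 1) p
        = ∑ q ∈ Finset.range N, d q * linearSyzygy b a (q + 1) p := by
      refine Finset.sum_congr rfl fun x hx => ?_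
      rw [if_pos (by simpa using hx)]
    rw [h4]
    rcases Nat.lt_or_ge p (N + 1) with hp' | hp'
    · rw [← hd p hp']
      ring
    · obtain rfl : p = N + 1 := by omega
      rw [Finset.sum_eq_zero, hc', linearSyzygy, if_pos rfl]
      · linear_combination -b * c' * hu'
      · intro q hq
        simp at hq
        rw [linearSyzygy, if_neg (by omega), if_neg (by omega), mul_zero]

include h0 in
/-- The linear syzygies are linearly independent. -/
theorem eq_zero_of_sum_linearSyzygy {N : ℕ} (d : ℕ → S) (hu : ∀ j : ℕ, IsUnit ((j + 1 : ℕ) : S))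
    (hd : ∀ p < N + 1, ∑ q ∈ Finset.range N, d q * linearSyzygy b a (q + 1) p = 0) :
    ∀ q < N, d q = 0 := by
  induction N with
  | zero => simp
  | succ N ih =>
    -- The syzygy matrix is triangular with diagonal entries `-(q + 1) * b`, so the bottom row
    -- isolates the last coefficient.
    have h := hd (N + 1) (by omega)
    rw [Finset.sum_range_succ, Finset.sum_eq_zero, zero_add, linearSyzygy, if_pos rfl] at h
    · have hN : d N = 0 := by
        apply h0
        rw [← (hu N).mul_right_eq_zero, ← neg_eq_zero, ← h]
        ring
      intro q hq
      rcases Nat.lt_or_ge q N with hq' | hq'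
      · refine ih (fun p hp => ?_) q hq'
        have := hd p (by omega)
        rwa [Finset.sum_range_succ, hN, zero_mul, add_zero] at this
      · rwa [show q = N by omega]
    · intro q hq
      simp at hq
      rw [linearSyzygy, if_neg (by omega), if_neg (by omega), mul_zero]

include h0 h1 hu in
-- From `I_{N+1} = b I_N + (q_N)`: the coefficient of `q_N` in `b * x` is divisible by `b`, and
-- after cancelling `b` one uses `q_N ∈ I_N`.
theorem mem_tailPartialIdeal_of_mul_mem {N : ℕ} (hN : 1 ≤ N) {x : S}
    (hx : b * x ∈ tailPartialIdeal b a (N + 1)) : x ∈ tailPartialIdeal b a N := by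
  obtain ⟨c, hc⟩ := mem_tailPartialIdeal.1 hx
  have hs : ∑ p ∈ Finset.range N, c p * tailPartial b a (N + 1) p =
      b * ∑ p ∈ Finset.range N, c p * tailPartial b a N p := by
    rw [Finset.mul_sum]
    refine Finset.sum_congr rfl fun p hp => ?_
    rw [← mul_tailPartial b a (by simpa using hp)]
    ring
  rw [Finset.sum_range_succ, hs] at hc
  have hY : tailPartial b a (N + 1) N = hessenbergSq b a N := by simp [tailPartial]
  rw [hY] at hc
  obtain ⟨y, hy⟩ := dvd_of_mul_hessenbergSq_mem h1 hu (N := N) (x := c N) (by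
    rw [Ideal.mem_span_singleton]
    exact ⟨x - ∑ p ∈ Finset.range N, c p * tailPartial b a N p, by rw [mul_sub, hc]; ring⟩)
  have hx' : x = ∑ p ∈ Finset.range N, c p * tailPartial b a N p + y * hessenbergSq b a N := by
    rw [← sub_eq_zero]
    apply h0
    rw [mul_sub, hc, hy]
    ring
  rw [hx']
  refine add_mem (Ideal.sum_mem _ fun p hp => Ideal.mul_mem_left _ _ (tailPartial_mem ?_))
    (Ideal.mul_mem_left _ _ (hessenbergSq_mem hN hu))
  simpa using hp

include h0 h1 hu in
-- Each removed factor `b` lowers the order by one, ending at order two, whose ideal lies in `(b, a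
-- 1)`.
theorem mem_span_of_mul_pow_mem {m : ℕ} {x : S} (hx : x * b ^ m ∈ tailPartialIdeal b a (m + 2)) :
    x ∈ Ideal.span {b, a 1} := by
  induction m with
  | zero => exact tailPartialIdeal_le le_rfl hu (by simpa using hx)
  | succ m ih =>
    apply ih
    apply mem_tailPartialIdeal_of_mul_mem h0 h1 hu (by omega)
    convert hx using 1
    ring

theorem mul_pow_mem (m : ℕ) (hu : ∀ j : ℕ, IsUnit ((j + 1 : ℕ) : S)) {x : S}
    (hx : x ∈ Ideal.span {b, a 1}) : x * b ^ m ∈ tailPartialIdeal b a (m + 2) := by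
  obtain ⟨y, z, rfl⟩ := Ideal.mem_span_pair.1 hx
  have e1 : tailPartial b a (m + 2) 0 = b ^ (m + 1) := by simp [tailPartial, hessenbergSq_zero]
  have e2 := pow_mul_tailPartial_mem (b := b) (a := a) hu (N := m + 1) (m := 0) (j := 1)
    (by omega) (by omega)
  have e3 : tailPartial b a (m + 1) 0 = b ^ m := by simp [tailPartial, hessenbergSq_zero]
  have e4 := tailPartial_mem (b := b) (a := a) (N := m + 2) (p := 0) (by omega)
  rw [e1] at e4
  rw [e3] at e2
  convert add_mem (Ideal.mul_mem_left _ y e4) (Ideal.mul_mem_left _ z e2) using 1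
  ring

variable (h2 : ∀ x, a 2 * x ∈ Ideal.span {b, a 1} → x ∈ Ideal.span {b, a 1})

include h2 in
theorem pow_two_mul_mem_span (j : ℕ) {x : S} (hx : a 2 ^ j * x ∈ Ideal.span {b, a 1}) :
    x ∈ Ideal.span {b, a 1} := by
  induction j with
  | zero => simpa using hx
  | succ j ih =>
    apply ih
    apply h2
    rwa [← mul_assoc, ← pow_succ']

include h0 h1 hu h2 in
theorem mem_span_of_mul_lastPartial_mem (m : ℕ) {x : S}
    (hx : x * lastPartial b a (m + 1) ∈ tailPartialIdeal b a (m + 2)) :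
    x ∈ Ideal.span {b, a 1 ^ (m + 1)} := by
  suffices H : ∀ j ≤ m + 1, x ∈ Ideal.span {b, a 1 ^ j} from H _ le_rfl
  intro j
  induction j with
  | zero =>
    intro _
    rw [pow_zero, Ideal.eq_top_of_isUnit_mem (Ideal.span {b, (1 : S)})
      (Ideal.subset_span (by simp)) isUnit_one]
    trivial
  | succ j ih =>
    intro hj
    -- Write `x = y b + v a_1^j`. Multiplying by `a_1^(m-j)` gives `v a_1^m G ∈ I`, hence `v
    -- a_2^(m+1) b^m ∈ I`. Therefore `v ∈ (b, a_1)`, and the exponent `j` can be raised by one.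
    obtain ⟨y, v, rfl⟩ := Ideal.mem_span_pair.1 (ih (by omega))
    have hbG := mul_lastPartial_mem (b := b) (a := a) (m + 1)
    have hv : v * (a 1 ^ m * lastPartial b a (m + 1)) ∈ tailPartialIdeal b a (m + 2) := by
      have h3 := Ideal.mul_mem_left _ (a 1 ^ (m - j))
        (sub_mem hx (Ideal.mul_mem_left _ y hbG))
      convert h3 using 1
      rw [show a 1 ^ m = a 1 ^ (m - j) * a 1 ^ j by rw [← pow_add]; congr 1; omega]
      ring
    have h4 := sub_mem (Ideal.mul_mem_left _ 3 hv) (Ideal.mul_mem_left _ v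
      (pow_mul_lastPartial_sub_mem (b := b) (a := a) hu m))
    have h5 : (a 2 ^ (m + 1) * v) * b ^ m ∈ tailPartialIdeal b a (m + 2) := by
      rw [← (Ideal.unit_mul_mem_iff_mem _ (hu (m + 2))),
        ← (Ideal.unit_mul_mem_iff_mem _ (((isUnit_one (M := S)).neg).pow m))]
      convert h4 using 1
      ring
    have h6 := pow_two_mul_mem_span h2 _ (mem_span_of_mul_pow_mem h0 h1 hu h5)
    obtain ⟨s, t, rfl⟩ := Ideal.mem_span_pair.1 h6
    rw [Ideal.mem_span_pair]
    exact ⟨y + s * a 1 ^ j, t, by ring⟩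

theorem mul_lastPartial_mem_of_mem_span (hu : ∀ j : ℕ, IsUnit ((j + 1 : ℕ) : S)) (m : ℕ) {x : S}
    (hx : x ∈ Ideal.span {b, a 1 ^ m}) :
    x * lastPartial b a m ∈ tailPartialIdeal b a (m + 1) := by
  obtain ⟨y, z, rfl⟩ := Ideal.mem_span_pair.1 hx
  convert add_mem (Ideal.mul_mem_left _ y (mul_lastPartial_mem (b := b) (a := a) m))
    (Ideal.mul_mem_left _ z (pow_succ_mul_lastPartial_mem (b := b) (a := a) hu m)) using 1
  ring

include h0 h1 hu h2 in
/-- The annihilator of `(b * a 2) ^ (m + 1)` modulo the gradient ideal. -/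
theorem mul_socle_mem_iff (m : ℕ) (x : S) :
    x * (b * a 2) ^ (m + 1) ∈
      tailPartialIdeal b a (m + 3) ⊔ Ideal.span {lastPartial b a (m + 2)} ↔
    x ∈ Ideal.span {b, a 1, a 2} := by
  have hC := pow_mul_lastPartial_sub_mem (b := b) (a := a) hu (m + 1)
  constructor
  · intro hx
    obtain ⟨y, hy, z, hz, hyz⟩ := Submodule.mem_sup.1 hx
    obtain ⟨v, rfl⟩ := Ideal.mem_span_singleton'.1 hz
    -- Here `x (b a_2)^(m+1) = y + v G`. Since `a_1 b^(m+1) ∈ I`, the multiple `a_1 v` annihilates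
    -- `G`; the known annihilator then gives `v ≡ t a_1^(m+1)` modulo `b`.
    have h3 : (a 1 * v) * lastPartial b a (m + 2) ∈ tailPartialIdeal b a (m + 3) := by
      have h4 := mul_pow_mem (b := b) (a := a) (m + 1) hu (x := x * a 2 ^ (m + 1) * a 1)
        (Ideal.mul_mem_left _ _ (Ideal.subset_span (by simp)))
      convert sub_mem h4 (Ideal.mul_mem_left _ (a 1) hy) using 1
      linear_combination a 1 * hyz
    have h4 := mem_span_of_mul_lastPartial_mem h0 h1 hu h2 (m + 1) h3
    obtain ⟨s, t, hst⟩ := Ideal.mem_span_pair.1 h4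
    have h5 : v - t * a 1 ^ (m + 1) ∈ Ideal.span {b} := by
      apply h1
      rw [Ideal.mem_span_singleton']
      exact ⟨s, by linear_combination hst⟩
    obtain ⟨w, hw⟩ := Ideal.mem_span_singleton'.1 h5
    have h6 := Ideal.mul_mem_left _ (3 * w) (mul_lastPartial_mem (b := b) (a := a) (m + 2))
    -- Substituting for `v` and replacing `a_1^(m+1) G` by its multiple of `a_2^(m+2) b^(m+1)`
    -- leaves a multiple of `b^(m+1)` in `I`. The colon ideals then put `3 x` in `(b, a_1, a_2)`.
    have h7 : (a 2 ^ (m + 1) * (3 * x - (-1) ^ (m + 1) * ((m + 1 + 3 : ℕ) : S) * t * a 2)) *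
        b ^ (m + 1) ∈ tailPartialIdeal b a (m + 3) := by
      have h8 := add_mem (add_mem (Ideal.mul_mem_left _ 3 hy) (Ideal.mul_mem_left _ t hC)) h6
      convert h8 using 1
      linear_combination (-3) * hyz - 3 * lastPartial b a (m + 2) * hw
    have h8 := pow_two_mul_mem_span h2 _ (mem_span_of_mul_pow_mem h0 h1 hu h7)
    have h9 : Ideal.span {b, a 1} ≤ Ideal.span {b, a 1, a 2} :=
      Ideal.span_mono (by intro z; simp; tauto)
    rw [← (Ideal.unit_mul_mem_iff_mem _ (hu 2))]
    convert add_mem (h9 h8) (Ideal.mul_mem_left _ ((-1) ^ (m + 1) * ((m + 1 + 3 : ℕ) : S) * t)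
      (Ideal.subset_span (s := {b, a 1, a 2}) (a := a 2) (by simp))) using 1
    push_cast
    ring
  · intro hx
    rw [Ideal.mem_span_insert] at hx
    obtain ⟨s, z, hz, rfl⟩ := hx
    obtain ⟨t, u, rfl⟩ := Ideal.mem_span_pair.1 hz
    have h3 := mul_pow_mem (b := b) (a := a) (m + 1) hu (x := (s * b + t * a 1) * a 2 ^ (m + 1))
      (Ideal.mul_mem_right _ _ (Ideal.mem_span_pair.2 ⟨s, t, rfl⟩))
    have h4 : a 2 ^ (m + 2) * b ^ (m + 1) ∈
        tailPartialIdeal b a (m + 3) ⊔ Ideal.span {lastPartial b a (m + 2)} := by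
      rw [← (Ideal.unit_mul_mem_iff_mem _ (hu (m + 3))),
        ← (Ideal.unit_mul_mem_iff_mem _ (((isUnit_one (M := S)).neg).pow (m + 1)))]
      have h5 := sub_mem ((le_sup_right : _ ≤ tailPartialIdeal b a (m + 3) ⊔ Ideal.span {lastPartial b a (m + 2)})
        (Ideal.mul_mem_left _ (3 * a 1 ^ (m + 1))
        (Ideal.mem_span_singleton_self (lastPartial b a (m + 2)))))
        ((le_sup_left : _ ≤ tailPartialIdeal b a (m + 3) ⊔ Ideal.span {lastPartial b a (m + 2)})
        hC)
      convert h5 using 1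
      push_cast
      ring
    convert add_mem (Ideal.mem_sup_left h3) (Ideal.mul_mem_left _ u h4) using 1
    ring

end RegularTriple

/-! ### Hessenberg determinants and their derivatives -/

section HessenbergDeterminant

variable {S : Type*} [CommRing S] {b : S} {a : ℕ → S}

variable (a) in
/-- The Toeplitz Hessenberg matrix with diagonals `a 0, a 1, …`, its first row replaced by `c`. -/
def hessenbergMatrix (c : ℕ → S) (m : ℕ) : Matrix (Fin m) (Fin m) S :=
  Matrix.of fun i j => if (i : ℕ) = 0 then c j else if (i : ℕ) ≤ j + 1 then a (j + 1 - i) else 0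

/-- Expand along the first column, whose only possibly nonzero entries are `c 0` and `a 0 = -b`.
Both minors are again of this form, with a new first row; keeping that row arbitrary lets the
induction close. -/
theorem det_hessenbergMatrix (hab : a 0 = -b) (c : ℕ → S) (m : ℕ) :
    (hessenbergMatrix a c (m + 1)).det =
      ∑ r ∈ Finset.range (m + 1), b ^ r * c r * hessenbergSeq b a (m - r) := by
  induction m generalizing c with
  | zero => simp [hessenbergMatrix, hessenbergSeq_zero]
  | succ m ih =>
    rw [Matrix.det_succ_column_zero, Fin.sum_univ_succ, Fin.sum_univ_succ, Finset.sum_eq_zero]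
    · have e1 : (hessenbergMatrix a c (m + 1 + 1)).submatrix (Fin.succAbove 0) Fin.succ =
          hessenbergMatrix a (fun r => a (r + 1)) (m + 1) := by
        ext i j
        simp only [hessenbergMatrix, Matrix.submatrix_apply, Matrix.of_apply, Fin.zero_succAbove,
          Fin.val_succ, Nat.add_sub_add_right, add_le_add_iff_right]
        by_cases hi : (i : ℕ) = 0
        · simp [hi]
        · simp [hi]
      have e2 : (hessenbergMatrix a c (m + 1 + 1)).submatrix
          (Fin.succAbove (Fin.succ 0)) Fin.succ =
          hessenbergMatrix a (fun r => c (r + 1)) (m + 1) := by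
        ext i j
        cases i using Fin.cases with
        | zero => simp [hessenbergMatrix]
        | succ i =>
          rw [Matrix.submatrix_apply, Fin.succ_succAbove_succ, Fin.zero_succAbove]
          simp [hessenbergMatrix]
      rw [e1, e2, ih, ih, Finset.sum_range_succ' _ (m + 1), Nat.sub_zero, hessenbergSeq_succ]
      have e3 : ∑ r ∈ Finset.range (m + 1), b ^ (r + 1) * c (r + 1) *
          hessenbergSeq b a (m + 1 - (r + 1)) = b * ∑ r ∈ Finset.range (m + 1),
          b ^ r * c (r + 1) * hessenbergSeq b a (m - r) := by
        rw [Finset.mul_sum]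
        refine Finset.sum_congr rfl fun r _ => ?_
        rw [Nat.add_sub_add_right]
        ring
      rw [e3]
      simp [hessenbergMatrix, hab]
      ring
    · intro i _
      simp [hessenbergMatrix]

/-- Apply `δ` coefficientwise to `D = 1 + K D`: then `(1-K) δD = D δK`, and multiplying by `D =
1/(1-K)` gives `δD = D² δK`. -/
theorem derivation_hessenbergSeq {k : Type*} [CommRing k] [Algebra k S] (δ : Derivation k S S)
    (m : ℕ) : δ (hessenbergSeq b a (m + 1)) =
      ∑ r ∈ Finset.range (m + 1), δ (b ^ r * a (r + 1)) * hessenbergSq b a (m - r) := by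
  let Δ : PowerSeries S → PowerSeries S := fun B =>
    PowerSeries.mk fun j => δ (PowerSeries.coeff j B)
  have hmul : ∀ B B', Δ (B * B') = B * Δ B' + Δ B * B' := by
    intro B B'
    ext j
    simp only [Δ, PowerSeries.coeff_mk, PowerSeries.coeff_mul, map_add, map_sum,
      Derivation.leibniz, smul_eq_mul, Finset.sum_add_distrib]
    congr 1
    exact Finset.sum_congr rfl fun _ _ => mul_comm _ _
  have hadd : ∀ B B', Δ (B + B') = Δ B + Δ B' := by
    intro B B'
    ext j
    simp [Δ]
  have hone : Δ 1 = 0 := by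
    ext j
    simp only [Δ, PowerSeries.coeff_mk, PowerSeries.coeff_one]
    split_ifs <;> simp
  set D := PowerSeries.mk (hessenbergSeq b a) with hD
  set K := symbolSeries b a with hK
  have h1 : D = 1 + K * D := mk_hessenbergSeq b a
  have h2 : Δ D = K * Δ D + Δ K * D := by
    conv_lhs => rw [h1]
    rw [hadd, hmul, hone, zero_add]
  have h3 : Δ D = Δ K * PowerSeries.mk (hessenbergSq b a) := by
    rw [mk_hessenbergSq]
    linear_combination D * h2 - Δ D * h1
  have h4 : Δ K = PowerSeries.X * PowerSeries.mk fun r => δ (b ^ r * a (r + 1)) := by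
    ext j
    cases j with
    | zero => simp [Δ, hK, symbolSeries]
    | succ j => simp [Δ, hK, symbolSeries, PowerSeries.coeff_succ_X_mul]
  rw [h4, mul_assoc] at h3
  have h5 := congrArg (PowerSeries.coeff (m + 1)) h3
  rw [PowerSeries.coeff_succ_X_mul, PowerSeries.coeff_mul,
    Finset.Nat.sum_antidiagonal_eq_sum_range_succ_mk] at h5
  simpa [Δ, hD] using h5

end HessenbergDeterminant

/-! ### The sub-Hankel determinant as a Hessenberg determinant -/

section Coefficients

variable (k : Type*) [Field k] (n : ℕ)

/-- The negative of the variable `x_n`. -/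
def subdiag : MvPolynomial (Fin (n + 1)) k := -X (Fin.last n)

/-- The variables in reverse order, `diag i = x_{n-i}`. -/
def diag (i : ℕ) : MvPolynomial (Fin (n + 1)) k :=
  if i ≤ n then X ⟨n - i, Nat.lt_succ_of_le (Nat.sub_le n i)⟩ else 0

theorem diag_zero : diag k n 0 = -subdiag k n := by
  simp [diag, subdiag, Fin.last]

variable {n} in
-- Reversing the columns gives the Hessenberg matrix; `u` is the sign of that permutation, which
-- does not affect the ideals of partials.
theorem exists_mul_subHankelDet (hn : 1 ≤ n) : ∃ u : ℤˣ,
    hessenbergSeq (subdiag k n) (diag k n) n = (u : ℤ) • subHankelDet k n := by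
  obtain ⟨m, rfl⟩ : ∃ m, n = m + 1 := ⟨n - 1, by omega⟩
  refine ⟨Equiv.Perm.sign (Fin.revPerm : Equiv.Perm (Fin (m + 1))), ?_⟩
  have h := det_hessenbergMatrix (diag_zero k (m + 1)) (fun r => diag k (m + 1) (r + 1)) m
  rw [← hessenbergSeq_succ] at h
  rw [← h, subHankelDet, zsmul_eq_mul, ← Matrix.det_permute']
  congr 1
  ext1 i j
  have hi := i.2
  have hj := j.2
  simp only [hessenbergMatrix, subHankelMatrix, Matrix.of_apply, Matrix.submatrix_apply, id,
    Fin.revPerm_apply, Fin.val_rev, diag]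
  by_cases h1 : (i : ℕ) ≤ j + 1
  · rw [dif_pos (by omega)]
    by_cases h0 : (i : ℕ) = 0
    · rw [if_pos h0, if_pos (by omega)]
      congr 1
      ext
      simp only
      omega
    · rw [if_neg h0, if_pos h1, if_pos (by omega)]
      congr 1
      ext
      simp only
      omega
  · rw [dif_neg (by omega), if_neg (by omega), if_neg (by omega)]

/-- Among the terms `b ^ r * a (r + 1)`, only that with `r = n - 1 - p` contains `x_p`, and there
linearly. -/
theorem pderiv_hessenbergSeq_castSucc (p : Fin n) :
    pderiv p.castSucc (hessenbergSeq (subdiag k n) (diag k n) n) =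
      tailPartial (subdiag k n) (diag k n) n p := by
  obtain ⟨m, rfl⟩ : ∃ m, n = m + 1 := ⟨n - 1, by have := p.2; omega⟩
  have hb : pderiv p.castSucc (subdiag k (m + 1)) = 0 := by
    rw [subdiag, map_neg, pderiv_X_of_ne (by simp [Fin.ext_iff]; have := p.2; omega), neg_zero]
  have hp := p.2
  rw [derivation_hessenbergSeq, Finset.sum_eq_single (m - p), Derivation.leibniz,
    Derivation.leibniz_pow, hb, diag, if_pos (by omega)]
  · have : (⟨m + 1 - (m - p + 1), by omega⟩ : Fin (m + 1 + 1)) = p.castSucc := by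
      ext; simp; omega
    rw [this, pderiv_X_self, show m - (m - (p : ℕ)) = p by omega]
    simp [tailPartial]
  · intro r hr hrp
    simp at hr
    rw [Derivation.leibniz, Derivation.leibniz_pow, hb, diag, if_pos (by omega),
      pderiv_X_of_ne]
    · simp
    · simp [Fin.ext_iff]
      omega
  · intro h
    simp at h

/-- The coefficients `a 1, …, a n` do not involve `x_n`, so only the powers of `b = -x_n` are
differentiated. -/
theorem pderiv_hessenbergSeq_last (hn : 1 ≤ n) :
    pderiv (Fin.last n) (hessenbergSeq (subdiag k n) (diag k n) n) =
      -lastPartial (subdiag k n) (diag k n) (n - 1) := by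
  obtain ⟨m, rfl⟩ : ∃ m, n = m + 1 := ⟨n - 1, by omega⟩
  have hb : pderiv (Fin.last (m + 1)) (subdiag k (m + 1)) = -1 := by
    rw [subdiag, map_neg, pderiv_X_self]
  have ha : ∀ r ≤ m, pderiv (Fin.last (m + 1)) (diag k (m + 1) (r + 1)) = 0 := by
    intro r hr
    rw [diag, if_pos (by omega), pderiv_X_of_ne]
    simp [Fin.ext_iff]
    omega
  rw [derivation_hessenbergSeq, Finset.sum_range_succ', lastPartial, Nat.add_sub_cancel,
    ← Finset.sum_neg_distrib]
  have h0 : pderiv (Fin.last (m + 1)) (subdiag k (m + 1) ^ 0 * diag k (m + 1) (0 + 1)) = 0 := by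
    rw [pow_zero, one_mul, ha 0 (by omega)]
  rw [h0, zero_mul, add_zero]
  refine Finset.sum_congr rfl fun r hr => ?_
  simp at hr
  rw [Derivation.leibniz, ha _ (by omega), Derivation.leibniz_pow, hb, tailPartial,
    show m - 1 - (m - 1 - r) = r by omega, show m - 1 - r = m - (r + 1) by omega]
  simp
  ring

variable {n} in
theorem subgradientIdeal_eq (hn : 1 ≤ n) :
    subgradientIdeal k n = tailPartialIdeal (subdiag k n) (diag k n) n := by
  obtain ⟨u, hu⟩ := exists_mul_subHankelDet k hn
  rw [subgradientIdeal, tailPartialIdeal]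
  have h : ∀ i : Fin n, tailPartial (subdiag k n) (diag k n) n i =
      (u : ℤ) • pderiv i.castSucc (subHankelDet k n) := by
    intro i
    rw [← pderiv_hessenbergSeq_castSucc, hu, map_zsmul]
  rcases Int.units_eq_one_or u with rfl | rfl
  · simp only [h, Units.val_one, one_smul]
  · simp only [h, Units.val_neg, Units.val_one, neg_smul, one_smul]
    apply le_antisymm <;> rw [Ideal.span_le] <;> rintro _ ⟨i, rfl⟩
    · exact neg_mem_iff.1 (Ideal.subset_span ⟨i, rfl⟩)
    · exact neg_mem (Ideal.subset_span ⟨i, rfl⟩)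

variable {n} in
theorem gradientIdeal_eq (hn : 1 ≤ n) :
    gradientIdeal k n = tailPartialIdeal (subdiag k n) (diag k n) n ⊔
      Ideal.span {lastPartial (subdiag k n) (diag k n) (n - 1)} := by
  obtain ⟨u, hu⟩ := exists_mul_subHankelDet k hn
  have h1 : gradientIdeal k n = subgradientIdeal k n ⊔
      Ideal.span {pderiv (Fin.last n) (subHankelDet k n)} := by
    rw [gradientIdeal, subgradientIdeal, ← Ideal.span_union]
    congr 1
    ext x
    simp only [Set.mem_range, Set.mem_union, Set.mem_singleton_iff, Fin.exists_fin_succ',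
      eq_comm]
  rw [h1, subgradientIdeal_eq k hn]
  congr 1
  have h2 := pderiv_hessenbergSeq_last k n hn
  rw [hu, map_zsmul] at h2
  rw [← Ideal.span_singleton_neg (lastPartial _ _ _), ← h2]
  rcases Int.units_eq_one_or u with rfl | rfl
  · simp
  · simp [Ideal.span_singleton_neg]

end Coefficients

/-! ### Degrees of the partials and syzygies -/

section Homogeneous

variable {k : Type*} [Field k] {σ : Type*} {b : MvPolynomial σ k} {a : ℕ → MvPolynomial σ k}
  (hb : b.IsHomogeneous 1) (ha : ∀ i, (a i).IsHomogeneous 1)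
include hb ha

theorem isHomogeneous_hessenbergSeq (m : ℕ) : (hessenbergSeq b a m).IsHomogeneous m := by
  induction m using Nat.strong_induction_on with
  | _ m ih =>
    cases m with
    | zero => rw [hessenbergSeq_zero]; exact isHomogeneous_one _ _
    | succ m =>
      rw [hessenbergSeq_succ]
      refine IsHomogeneous.sum _ _ _ fun r hr => ?_
      simp at hr
      convert ((hb.pow r).mul (ha (r + 1))).mul (ih (m - r) (by omega)) using 1
      omega

theorem isHomogeneous_tailPartial {N p : ℕ} (h : p < N) :
    (tailPartial b a N p).IsHomogeneous (N - 1) := by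
  have h1 : (hessenbergSq b a p).IsHomogeneous p := by
    refine IsHomogeneous.sum _ _ _ fun r hr => ?_
    rw [← Finset.HasAntidiagonal.mem_antidiagonal.1 hr]
    exact (isHomogeneous_hessenbergSeq hb ha r.1).mul (isHomogeneous_hessenbergSeq hb ha r.2)
  have h2 := (hb.pow (N - 1 - p)).mul h1
  rw [show 1 * (N - 1 - p) + p = N - 1 by omega] at h2
  exact h2

omit hb ha in
theorem isHomogeneous_natCast_mul (m : ℕ) {x : MvPolynomial σ k} {d : ℕ}
    (hx : x.IsHomogeneous d) : ((m : MvPolynomial σ k) * x).IsHomogeneous d := by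
  rw [← map_natCast (C : k →+* MvPolynomial σ k)]
  exact hx.C_mul _

theorem isHomogeneous_lastPartial (m : ℕ) : (lastPartial b a m).IsHomogeneous m := by
  refine IsHomogeneous.sum _ _ _ fun r hr => ?_
  simp at hr
  convert (isHomogeneous_natCast_mul (r + 1) (ha (r + 2))).mul
    (isHomogeneous_tailPartial hb ha (N := m) (p := m - 1 - r) (by omega)) using 1
  omega

theorem isHomogeneous_linearSyzygy (m p : ℕ) : (linearSyzygy b a m p).IsHomogeneous 1 := by
  rw [linearSyzygy]
  split_ifs
  · rw [neg_mul]
    exact (isHomogeneous_natCast_mul m hb).neg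
  · exact isHomogeneous_natCast_mul _ (ha _)
  · exact isHomogeneous_zero _ _ _

end Homogeneous

/-! ### Regularity of variables modulo ideals of variables -/

section Variables

variable {k : Type*} [Field k] {σ : Type*}

/-- Membership is tested monomial by monomial, and multiplication by `X j` leaves the exponents of
the variables in `s` unchanged. -/
theorem mem_span_X_of_X_mul_mem {s : Set σ} {j : σ} (hj : j ∉ s) {x : MvPolynomial σ k}
    (hx : X j * x ∈ Ideal.span (X '' s : Set (MvPolynomial σ k))) :
    x ∈ Ideal.span (X '' s : Set (MvPolynomial σ k)) := by
  rw [mem_ideal_span_X_image] at hx ⊢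
  intro m hm
  obtain ⟨i, hi, hmi⟩ := hx (Finsupp.single j 1 + m) (by
    rw [mem_support_iff] at hm ⊢
    rwa [coeff_X_mul])
  refine ⟨i, hi, ?_⟩
  have : j ≠ i := fun h => hj (h ▸ hi)
  simpa [Finsupp.single_apply, this] using hmi

end Variables

/-! ### The sequence `x_n, x_{n-1}, x_{n-2}` is regular -/

section Coefficients

variable (k : Type*) [Field k] (n : ℕ)

theorem isHomogeneous_subdiag : (subdiag k n).IsHomogeneous 1 :=
  (isHomogeneous_X _ _).neg

theorem isHomogeneous_diag (i : ℕ) : (diag k n i).IsHomogeneous 1 := by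
  rw [diag]
  split_ifs
  · exact isHomogeneous_X _ _
  · exact isHomogeneous_zero _ _ _

variable {k n}

theorem subdiag_mul_eq_zero (x : MvPolynomial (Fin (n + 1)) k) (h : subdiag k n * x = 0) :
    x = 0 := by
  simpa [subdiag, X_ne_zero] using h

theorem span_subdiag :
    Ideal.span {subdiag k n} = Ideal.span (X '' {Fin.last n}) := by
  rw [Set.image_singleton, subdiag, Ideal.span_singleton_neg]

theorem span_subdiag_pair (hn : 1 ≤ n) : Ideal.span {subdiag k n, diag k n 1} =
    Ideal.span (X '' {Fin.last n, ⟨n - 1, by omega⟩}) := by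
  rw [Set.image_pair, subdiag, Ideal.span_insert_neg, diag, if_pos hn]

theorem span_subdiag_triple (hn : 2 ≤ n) : Ideal.span {subdiag k n, diag k n 1, diag k n 2} =
    Ideal.span (X '' {Fin.last n, ⟨n - 1, by omega⟩, ⟨n - 2, by omega⟩}) := by
  rw [Set.image_insert_eq, Set.image_pair, subdiag, Ideal.span_insert_neg, diag, diag,
    if_pos (by omega), if_pos hn]

theorem mem_span_subdiag_pair (hn : 2 ≤ n) (x : MvPolynomial (Fin (n + 1)) k)
    (h : diag k n 2 * x ∈ Ideal.span {subdiag k n, diag k n 1}) :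
    x ∈ Ideal.span {subdiag k n, diag k n 1} := by
  rw [span_subdiag_pair (by omega)] at h ⊢
  rw [diag, if_pos hn] at h
  refine mem_span_X_of_X_mul_mem ?_ h
  simp [Fin.ext_iff]
  omega

theorem mem_span_subdiag (hn : 1 ≤ n) (x : MvPolynomial (Fin (n + 1)) k)
    (h : diag k n 1 * x ∈ Ideal.span {subdiag k n}) : x ∈ Ideal.span {subdiag k n} := by
  rw [span_subdiag] at h ⊢
  rw [diag, if_pos hn] at h
  refine mem_span_X_of_X_mul_mem ?_ h
  simp [Fin.ext_iff]
  omega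

theorem isUnit_natCast_succ [CharZero k] {σ : Type*} (j : ℕ) :
    IsUnit ((j + 1 : ℕ) : MvPolynomial σ k) := by
  rw [← map_natCast (C : k →+* MvPolynomial σ k)]
  exact (isUnit_iff_ne_zero.2 (Nat.cast_ne_zero.2 (Nat.succ_ne_zero j))).map C

end Coefficients

/-! ### Homogeneous components in graded free modules -/

section GradedFreeModules

variable {k : Type*} [Field k] {σ : Type*} {ι κ : Type*}

theorem mem_shiftGrading {a j : ℕ} {x : MvPolynomial σ k} :
    x ∈ shiftGrading (homogeneousSubmodule σ k) a j ↔
      if a ≤ j then x.IsHomogeneous (j - a) else x = 0 := by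
  unfold shiftGrading
  split_ifs <;> simp

theorem mem_freeGrading {t : ι → ℕ} {j : ℕ} {v : ι → MvPolynomial σ k} :
    v ∈ freeGrading t j ↔ ∀ i, if t i ≤ j then (v i).IsHomogeneous (j - t i) else v i = 0 := by
  simp only [GradedFreeComplex.Hom.mem_freeGrading, mem_shiftGrading]

theorem smul_mem_freeGrading {t : ι → ℕ} {d e : ℕ} {v : ι → MvPolynomial σ k}
    (hv : v ∈ freeGrading t d) {r : MvPolynomial σ k} (hr : r.IsHomogeneous e) :
    r • v ∈ freeGrading t (e + d) := by
  rw [mem_freeGrading] at hv ⊢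
  intro i
  have h := hv i
  by_cases hi : t i ≤ d
  · rw [if_pos hi] at h
    rw [if_pos (by omega)]
    rw [show e + d - t i = e + (d - t i) by omega]
    exact hr.mul h
  · rw [if_neg hi] at h
    have : (r • v) i = 0 := by simp [h]
    rw [this]
    split_ifs
    · exact isHomogeneous_zero _ _ _
    · rfl

/-- The component of degree `j` of an element of `⨁ i, R(-t i)`. -/
def freeComponent (t : ι → ℕ) (j : ℕ) :
    (ι → MvPolynomial σ k) →ₗ[k] (ι → MvPolynomial σ k) :=
  LinearMap.pi fun i =>
    if t i ≤ j then homogeneousComponent (j - t i) ∘ₗ LinearMap.proj i else 0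

theorem freeComponent_apply (t : ι → ℕ) (j : ℕ) (v : ι → MvPolynomial σ k) (i : ι) :
    freeComponent t j v i = if t i ≤ j then homogeneousComponent (j - t i) (v i) else 0 := by
  simp only [freeComponent, LinearMap.pi_apply]
  split_ifs <;> simp

theorem freeComponent_mem (t : ι → ℕ) (j : ℕ) (v : ι → MvPolynomial σ k) :
    freeComponent t j v ∈ freeGrading t j := by
  rw [mem_freeGrading]
  intro i
  rw [freeComponent_apply]
  split_ifs
  · exact homogeneousComponent_isHomogeneous _ _
  · rfl

theorem freeComponent_of_mem {t : ι → ℕ} {j j' : ℕ} {v : ι → MvPolynomial σ k}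
    (hv : v ∈ freeGrading t j) : freeComponent t j' v = if j' = j then v else 0 := by
  rw [mem_freeGrading] at hv
  funext i
  have h := hv i
  rw [freeComponent_apply]
  by_cases hi : t i ≤ j
  · rw [if_pos hi] at h
    by_cases hi' : t i ≤ j'
    · rw [if_pos hi', homogeneousComponent_of_mem h]
      by_cases e : j' = j
      · simp [e]
      · rw [if_neg (by omega), if_neg e]; rfl
    · rw [if_neg hi', if_neg (by omega)]; rfl
  · rw [if_neg hi] at h
    split_ifs <;> simp [h]

theorem exists_sum_freeComponent [Finite ι] (t : ι → ℕ) (v : ι → MvPolynomial σ k) :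
    ∃ N, ∑ j ∈ Finset.range N, freeComponent t j v = v := by
  cases nonempty_fintype ι
  refine ⟨∑ i, (t i + (v i).totalDegree) + 1, ?_⟩
  funext i
  rw [Finset.sum_apply]
  simp only [freeComponent_apply]
  have hi : t i + (v i).totalDegree ≤ ∑ i, (t i + (v i).totalDegree) :=
    Finset.single_le_sum (f := fun i => t i + (v i).totalDegree) (fun _ _ => Nat.zero_le _)
      (Finset.mem_univ i)
  set M := ∑ i, (t i + (v i).totalDegree)
  rw [show M + 1 = t i + (M + 1 - t i) by omega, Finset.sum_range_add,
    Finset.sum_eq_zero (fun x hx => if_neg (by simp at hx; omega)), zero_add]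
  simp only [Nat.le_add_right, if_true, Nat.add_sub_cancel_left]
  conv_rhs => rw [← sum_homogeneousComponent (v i)]
  symm
  apply Finset.sum_subset
  · intro x
    simp only [Finset.mem_range]
    omega
  · intro x _ hx
    exact homogeneousComponent_eq_zero _ _ (by simpa using hx)

/-- A homogeneous map of degree zero commutes with taking components. -/
theorem freeComponent_comm [Finite ι] {t : ι → ℕ} {t' : κ → ℕ}
    (d : (ι → MvPolynomial σ k) →ₗ[MvPolynomial σ k] (κ → MvPolynomial σ k))
    (hd : ∀ j, ∀ v ∈ freeGrading t j, d v ∈ freeGrading t' j)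
    (j : ℕ) (v : ι → MvPolynomial σ k) :
    freeComponent t' j (d v) = d (freeComponent t j v) := by
  have key : ∀ (N : ℕ) (w : ℕ → ι → MvPolynomial σ k), (∀ l, w l ∈ freeGrading t l) →
      freeComponent t' j (d (∑ l ∈ Finset.range N, w l)) =
        d (freeComponent t j (∑ l ∈ Finset.range N, w l)) := by
    intro N w hw
    simp only [map_sum]
    refine Finset.sum_congr rfl fun l _ => ?_
    rw [freeComponent_of_mem (hd _ _ (hw l)), freeComponent_of_mem (hw l)]
    split_ifs <;> simp
  obtain ⟨N, hN⟩ := exists_sum_freeComponent t v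
  rw [← hN]
  exact key N _ fun l => freeComponent_mem t l v

/-- A component of the right degree of any preimage is again a preimage; this makes the lifts of
chain maps homogeneous. -/
theorem exists_mem_freeGrading_of_mem_range [Finite ι] {t : ι → ℕ} {t' : κ → ℕ}
    (d : (ι → MvPolynomial σ k) →ₗ[MvPolynomial σ k] (κ → MvPolynomial σ k))
    (hd : ∀ j, ∀ v ∈ freeGrading t j, d v ∈ freeGrading t' j)
    {j : ℕ} {w : κ → MvPolynomial σ k} (hw : w ∈ freeGrading t' j) (h : ∃ v, d v = w) :
    ∃ v ∈ freeGrading t j, d v = w := by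
  obtain ⟨v, rfl⟩ := h
  refine ⟨freeComponent t j v, freeComponent_mem t j v, ?_⟩
  rw [← freeComponent_comm d hd, freeComponent_of_mem hw, if_pos rfl]

theorem linearCombination_mem_freeGrading [Fintype ι] {t : ι → ℕ} {t' : κ → ℕ}
    {c : ι → κ → MvPolynomial σ k} (hc : ∀ i, c i ∈ freeGrading t' (t i)) (j : ℕ)
    (v : ι → MvPolynomial σ k) (hv : v ∈ freeGrading t j) :
    Fintype.linearCombination (MvPolynomial σ k) c v ∈ freeGrading t' j := by
  rw [Fintype.linearCombination_apply]
  refine Submodule.sum_mem _ fun i _ => ?_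
  have h := mem_freeGrading.1 hv i
  by_cases hi : t i ≤ j
  · rw [if_pos hi] at h
    have h2 := smul_mem_freeGrading (hc i) h
    rwa [show j - t i + t i = j by omega] at h2
  · rw [if_neg hi] at h
    rw [h, zero_smul]
    exact zero_mem _

theorem single_mem_freeGrading [DecidableEq ι] (t : ι → ℕ) (i : ι) :
    (Pi.single i 1 : ι → MvPolynomial σ k) ∈ freeGrading t (t i) := by
  rw [mem_freeGrading]
  intro l
  by_cases h : l = i
  · subst h
    simp [isHomogeneous_one]
  · rw [Pi.single_eq_of_ne h]
    split_ifs
    · exact isHomogeneous_zero _ _ _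
    · rfl

theorem mem_irrelevantIdeal_of_isHomogeneous {x : MvPolynomial σ k} {d : ℕ}
    (hx : x.IsHomogeneous d) (hd : 0 < d) : x ∈ irrelevantIdeal σ k := by
  rw [irrelevantIdeal, ← Set.image_univ, mem_ideal_span_X_image]
  intro m hm
  by_contra! h
  have : m = 0 := by
    ext i
    exact h i trivial
  subst this
  have := hx.coeff_eq_zero (d := 0) (by simp; omega)
  exact (mem_support_iff.1 hm) this

/-- When every source twist exceeds every target twist, all matrix entries have positive degree.
Minimality throughout is deduced from this degree condition alone. -/
theorem mem_irrelevantIdeal_of_graded [Finite ι] {t : ι → ℕ} {t' : κ → ℕ}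
    (d : (ι → MvPolynomial σ k) →ₗ[MvPolynomial σ k] (κ → MvPolynomial σ k))
    (hd : ∀ j, ∀ v ∈ freeGrading t j, d v ∈ freeGrading t' j)
    (ht : ∀ i l, t' l < t i) (v : ι → MvPolynomial σ k) (l : κ) :
    d v l ∈ irrelevantIdeal σ k := by
  classical
  cases nonempty_fintype ι
  rw [LinearMap.pi_apply_eq_sum_univ d v, Finset.sum_apply]
  refine Ideal.sum_mem _ fun i _ => Ideal.mul_mem_left _ _ ?_
  have h := mem_freeGrading.1 (hd _ _ (single_mem_freeGrading t i)) l
  rw [if_pos (ht i l).le] at h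
  convert mem_irrelevantIdeal_of_isHomogeneous h (by have := ht i l; omega) using 2
  funext j
  simp [Pi.single_apply, eq_comm]

end GradedFreeModules

/-! ### Three-term complexes and mapping cones -/

namespace GradedFreeComplex

variable {k : Type*} [Field k] {σ : Type*}

section OfTwoMaps

variable {ι₀ ι₁ ι₂ : Type} [Fintype ι₀] [Fintype ι₁] [Fintype ι₂]

/-- The index types of a complex concentrated in degrees `0, 1, 2`. -/
def threeTerms (ι₀ ι₁ ι₂ : Type) : ℕ → Type
  | 0 => ι₀
  | 1 => ι₁
  | 2 => ι₂
  | _ + 3 => Empty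

/-- A complex `F₂ → F₁ → F₀` of graded free modules, extended by zero. -/
def ofTwoMaps (t₀ : ι₀ → ℕ) (t₁ : ι₁ → ℕ) (t₂ : ι₂ → ℕ)
    (d₀ : (ι₁ → MvPolynomial σ k) →ₗ[MvPolynomial σ k] (ι₀ → MvPolynomial σ k))
    (d₁ : (ι₂ → MvPolynomial σ k) →ₗ[MvPolynomial σ k] (ι₁ → MvPolynomial σ k))
    (h₀ : ∀ j, ∀ v ∈ freeGrading t₁ j, d₀ v ∈ freeGrading t₀ j)
    (h₁ : ∀ j, ∀ v ∈ freeGrading t₂ j, d₁ v ∈ freeGrading t₁ j)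
    (hd : ∀ v, d₀ (d₁ v) = 0) : GradedFreeComplex k σ where
  ι := threeTerms ι₀ ι₁ ι₂
  finite
    | 0 => (inferInstance : Fintype ι₀)
    | 1 => (inferInstance : Fintype ι₁)
    | 2 => (inferInstance : Fintype ι₂)
    | _ + 3 => (inferInstance : Fintype Empty)
  twist
    | 0 => t₀
    | 1 => t₁
    | 2 => t₂
    | _ + 3 => fun x : Empty => x.elim
  d
    | 0 => d₀
    | 1 => d₁
    | _ + 2 => 0
  d_graded
    | 0 => h₀
    | 1 => h₁
    | _ + 2 => fun _ _ _ => zero_mem _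
  d_comp_d
    | 0 => hd
    | 1 => fun _ => map_zero d₁
    | _ + 2 => fun _ => rfl

/-- A morphism between two complexes concentrated in degrees `0, 1, 2`. -/
def homOfThreeMaps {κ₀ κ₁ κ₂ : Type} [Fintype κ₀] [Fintype κ₁] [Fintype κ₂]
    {t₀ : ι₀ → ℕ} {t₁ : ι₁ → ℕ} {t₂ : ι₂ → ℕ}
    {d₀ : (ι₁ → MvPolynomial σ k) →ₗ[MvPolynomial σ k] (ι₀ → MvPolynomial σ k)}
    {d₁ : (ι₂ → MvPolynomial σ k) →ₗ[MvPolynomial σ k] (ι₁ → MvPolynomial σ k)} {h₀ h₁}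
    {hd : ∀ v, d₀ (d₁ v) = 0}
    {s₀ : κ₀ → ℕ} {s₁ : κ₁ → ℕ} {s₂ : κ₂ → ℕ}
    {e₀ : (κ₁ → MvPolynomial σ k) →ₗ[MvPolynomial σ k] (κ₀ → MvPolynomial σ k)}
    {e₁ : (κ₂ → MvPolynomial σ k) →ₗ[MvPolynomial σ k] (κ₁ → MvPolynomial σ k)} {g₀ g₁}
    {he : ∀ v, e₀ (e₁ v) = 0}
    (f₀ : (ι₀ → MvPolynomial σ k) →ₗ[MvPolynomial σ k] (κ₀ → MvPolynomial σ k))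
    (f₁ : (ι₁ → MvPolynomial σ k) →ₗ[MvPolynomial σ k] (κ₁ → MvPolynomial σ k))
    (f₂ : (ι₂ → MvPolynomial σ k) →ₗ[MvPolynomial σ k] (κ₂ → MvPolynomial σ k))
    (hf₀ : ∀ j, ∀ v ∈ freeGrading t₀ j, f₀ v ∈ freeGrading s₀ j)
    (hf₁ : ∀ j, ∀ v ∈ freeGrading t₁ j, f₁ v ∈ freeGrading s₁ j)
    (hf₂ : ∀ j, ∀ v ∈ freeGrading t₂ j, f₂ v ∈ freeGrading s₂ j)
    (c₀ : ∀ v, e₀ (f₁ v) = f₀ (d₀ v)) (c₁ : ∀ v, e₁ (f₂ v) = f₁ (d₁ v)) :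
    Hom (ofTwoMaps (k := k) (σ := σ) t₀ t₁ t₂ d₀ d₁ h₀ h₁ hd)
      (ofTwoMaps s₀ s₁ s₂ e₀ e₁ g₀ g₁ he) where
  f
    | 0 => f₀
    | 1 => f₁
    | 2 => f₂
    | _ + 3 => 0
  f_graded
    | 0 => hf₀
    | 1 => hf₁
    | 2 => hf₂
    | _ + 3 => fun _ _ _ => zero_mem _
  comm
    | 0 => c₀
    | 1 => c₁
    | 2 => fun _ => (map_zero f₂).symm
    | _ + 3 => fun _ => rfl

end OfTwoMaps

theorem minimal_of_twist_lt (F : GradedFreeComplex k σ)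
    (h : ∀ i a b, F.twist i b < F.twist (i + 1) a) (i : ℕ) (v : F.ι (i + 1) → MvPolynomial σ k)
    (a : F.ι i) : F.d i v a ∈ irrelevantIdeal σ k :=
  have := F.finite (i + 1)
  mem_irrelevantIdeal_of_graded (F.d i) (F.d_graded i) (fun i' l => h i i' l) v a

theorem ofTwoMaps_isMinimalResolution {ι₀ ι₁ ι₂ : Type} [Fintype ι₀] [Fintype ι₁] [Fintype ι₂]
    {t₀ : ι₀ → ℕ} {t₁ : ι₁ → ℕ} {t₂ : ι₂ → ℕ}
    {d₀ : (ι₁ → MvPolynomial σ k) →ₗ[MvPolynomial σ k] (ι₀ → MvPolynomial σ k)}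
    {d₁ : (ι₂ → MvPolynomial σ k) →ₗ[MvPolynomial σ k] (ι₁ → MvPolynomial σ k)} {h₀ h₁}
    {hd : ∀ v, d₀ (d₁ v) = 0}
    {M : Type*} [AddCommGroup M] [Module k M] [Module (MvPolynomial σ k) M]
    {ℳ : ℕ → Submodule k M} {ε : (ι₀ → MvPolynomial σ k) →ₗ[MvPolynomial σ k] M}
    (haug : ∀ j, ∀ v ∈ freeGrading (k := k) (σ := σ) t₀ j, ε v ∈ ℳ j)
    (hsurj : Function.Surjective ε) (hex₀ : Function.Exact d₀ ε) (hex₁ : Function.Exact d₁ d₀)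
    (hinj : Function.Injective d₁) (ht₀ : ∀ a b, t₀ b < t₁ a) (ht₁ : ∀ a b, t₁ b < t₂ a) :
    (ofTwoMaps (k := k) (σ := σ) t₀ t₁ t₂ d₀ d₁ h₀ h₁ hd).IsMinimalResolution ℳ ε where
  aug_graded := haug
  aug_surjective := hsurj
  exact_zero := hex₀
  exact_succ
    | 0 => hex₁
    -- The next term is zero, so exactness here is injectivity of `d₁`.
    | 1 => fun v => ⟨fun hv => ⟨0, (hinj (hv.trans (map_zero d₁).symm)).symm⟩, by
        rintro ⟨w, rfl⟩
        exact map_zero d₁⟩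
    | _ + 2 => fun v => ⟨fun _ => ⟨0, funext fun x : Empty => x.elim⟩, fun _ => rfl⟩
  minimal := minimal_of_twist_lt _ fun
    | 0 => ht₀
    | 1 => ht₁
    | _ + 2 => fun x : Empty => x.elim

namespace Hom

/-- The mapping cone of a lift of an inclusion `N ⊆ M` resolves `M ⧸ N`. -/
theorem cone_isMinimalResolution {C F : GradedFreeComplex k σ} (g : Hom C F)
    {M N Q : Type*} [AddCommGroup M] [Module k M] [Module (MvPolynomial σ k) M]
    [AddCommGroup N] [Module k N] [Module (MvPolynomial σ k) N]
    [AddCommGroup Q] [Module k Q] [Module (MvPolynomial σ k) Q]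
    {ℳ : ℕ → Submodule k M} {𝒩 : ℕ → Submodule k N} {𝒬 : ℕ → Submodule k Q} {εC εF}
    (hC : C.IsMinimalResolution 𝒩 εC) (hF : F.IsMinimalResolution ℳ εF)
    (i : N →ₗ[MvPolynomial σ k] M) (hi : Function.Injective i)
    (π : M →ₗ[MvPolynomial σ k] Q) (hπ : Function.Surjective π) (hiπ : Function.Exact i π)
    (hlift : ∀ v, εF (g.f 0 v) = i (εC v)) (hgr : ∀ j, ∀ x ∈ ℳ j, π x ∈ 𝒬 j)
    (ht : ∀ i a b, F.twist i b < C.twist i a)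
    (htF : ∀ i a b, F.twist i b < F.twist (i + 1) a)
    (htC : ∀ i a b, C.twist i b < C.twist (i + 1) a)
    (htFC : ∀ i a b, C.twist i b < F.twist (i + 2) a) :
    g.cone.IsMinimalResolution 𝒬 (π ∘ₗ εF) where
  aug_graded j v hv := hgr j _ (hF.aug_graded j v hv)
  aug_surjective := hπ.comp hF.aug_surjective
  exact_zero := fun (v : F.ι 0 → MvPolynomial σ k) => by
    constructor
    · intro hv
      obtain ⟨x, hx⟩ := (hiπ _).1 hv
      obtain ⟨c, rfl⟩ := hC.aug_surjective x
      obtain ⟨a, ha⟩ := (hF.exact_zero (v - g.f 0 c)).1 (by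
        rw [map_sub, hlift, hx]
        exact sub_self _)
      refine ⟨Sum.elim a c, ?_⟩
      change F.d 0 a + g.f 0 c = v
      rw [ha, sub_add_cancel]
    · rintro ⟨w, rfl⟩
      change π (εF (F.d 0 (fun a => w (Sum.inl a)) + g.f 0 (fun a => w (Sum.inr a)))) = 0
      rw [map_add, hF.exact_zero.apply_apply_eq_zero, zero_add, hlift,
        hiπ.apply_apply_eq_zero]
  exact_succ n v := by
    refine ⟨fun hv => ?_, fun ⟨w, hw⟩ => hw ▸ g.cone.d_comp_d n w⟩
    obtain ⟨c', hc'⟩ : ∃ c', C.d n c' = fun a => v (Sum.inr a) := by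
      cases n with
      | zero =>
        refine (hC.exact_zero _).1 (hi ?_)
        have hv' : F.d 0 (fun a => v (Sum.inl a)) + g.f 0 (fun a => v (Sum.inr a)) = 0 := hv
        have := congrArg εF hv'
        rw [map_add, hF.exact_zero.apply_apply_eq_zero, zero_add, hlift, map_zero] at this
        rw [this, map_zero]
      | succ n =>
        refine (hC.exact_succ n _).1 (funext fun a => ?_)
        have hv' : -(C.d n (fun a => v (Sum.inr a))) a = 0 := congrFun hv (Sum.inr a)
        exact neg_eq_zero.1 hv'
    have hl : F.d n (fun a => v (Sum.inl a)) + g.f n (fun a => v (Sum.inr a)) = 0 := by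
      cases n with
      | zero => exact hv
      | succ n => exact funext fun a => congrFun hv (Sum.inl a)
    obtain ⟨a', ha'⟩ := (hF.exact_succ n ((fun a => v (Sum.inl a)) + g.f (n + 1) c')).1 (by
      rw [map_add, g.comm, hc', hl])
    refine ⟨Sum.elim a' (-c'), funext ?_⟩
    rintro (a | a)
    · change (F.d (n + 1) a' + g.f (n + 1) (-c')) a = _
      rw [ha', map_neg, add_neg_cancel_right]
    · change (-(C.d n (-c'))) a = _
      rw [map_neg, neg_neg, hc']
  minimal := minimal_of_twist_lt _ fun
    | 0 => by
      rintro (a | a) b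
      · exact htF 0 a b
      · exact ht 0 a b
    | n + 1 => by
      rintro (a | a) (b | b)
      · exact htF (n + 1) a b
      -- This block of the cone differential is zero; its twist inequality is needed only because
      -- minimality is read off from degrees.
      · exact htFC n a b
      · exact ht (n + 1) a b
      · exact htC n a b

end Hom

end GradedFreeComplex

namespace GradedFreeComplex

variable {k : Type*} [Field k] {σ : Type*}

theorem Hom.cone_twists_succ {C F : GradedFreeComplex k σ} (g : Hom C F) (i : ℕ) :
    g.cone.twists (i + 1) = F.twists (i + 1) + C.twists i := by
  let _ := F.finite (i + 1)
  let _ := C.finite i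
  change (Finset.univ : Finset (F.ι (i + 1) ⊕ C.ι i)).val.map
    (Sum.elim (F.twist (i + 1)) (C.twist i)) = (Finset.univ : Finset (F.ι (i + 1))).val.map _ +
      (Finset.univ : Finset (C.ι i)).val.map _
  rw [← Finset.univ_disjSum_univ, Finset.val_disjSum, Multiset.disjSum, Multiset.map_add,
    Multiset.map_map, Multiset.map_map]
  rfl

theorem Hom.cone_d_zero_elim {C F : GradedFreeComplex k σ} (g : Hom C F)
    (a : F.ι 1 → MvPolynomial σ k) : g.cone.d 0 (Sum.elim a 0) = F.d 0 a := by
  change F.d 0 a + g.f 0 0 = _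
  rw [map_zero, add_zero]

theorem Hom.d_eq_zero_of_cone_d_eq_zero {C F : GradedFreeComplex k σ} (g : Hom C F) {i : ℕ}
    {a : F.ι (i + 2) → MvPolynomial σ k} {c : C.ι (i + 1) → MvPolynomial σ k} (hc : c = 0)
    (h : g.cone.d (i + 1) (Sum.elim a c) = 0) : F.d (i + 1) a = 0 := by
  have h1 : F.d (i + 1) a + g.f (i + 1) c = 0 := funext fun p => congrFun h (Sum.inl p)
  rwa [hc, map_zero, add_zero] at h1

end GradedFreeComplex

/-! ### Rank estimates over a Noetherian domain -/

section Rank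

variable {R : Type*} [CommRing R] [IsDomain R] [IsNoetherianRing R]

theorem finrank_range_lt {ι κ M : Type*} [Fintype ι] [Finite κ] [AddCommGroup M] [Module R M]
    (d₁ : M →ₗ[R] (ι → R)) (d₀ : (ι → R) →ₗ[R] (κ → R)) (h : ∀ v, d₀ (d₁ v) = 0) (hne : d₀ ≠ 0) :
    Module.finrank R (LinearMap.range d₁) < Fintype.card ι := by
  have h1 := Submodule.finrank_quotient_add_finrank (LinearMap.ker d₀)
  rw [Module.finrank_fintype_fun_eq_card, d₀.quotKerEquivRange.finrank_eq] at h1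
  have h2 : Module.finrank R (LinearMap.range d₁) ≤ Module.finrank R (LinearMap.ker d₀) :=
    Submodule.finrank_mono (by rintro _ ⟨v, rfl⟩; exact h v)
  have : Nontrivial (LinearMap.range d₀) := by
    rw [Submodule.nontrivial_iff_ne_bot]
    exact fun h => hne (LinearMap.range_eq_bot.1 h)
  have h3 : 0 < Module.finrank R (LinearMap.range d₀) := Module.finrank_pos
  omega

theorem le_finrank_of_injective {ι κ : Type*} [Fintype ι] [Fintype κ] (P : Submodule R (κ → R))
    (Ψ : (ι → R) →ₗ[R] (κ → R)) (hΨ : Function.Injective Ψ) (h : ∀ v, Ψ v ∈ P) :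
    Fintype.card ι ≤ Module.finrank R P := by
  rw [← Module.finrank_fintype_fun_eq_card R]
  exact LinearMap.finrank_le_finrank_of_injective (f := Ψ.codRestrict P h)
    (fun x y hxy => hΨ (congrArg Subtype.val hxy))

end Rank

/-! ### The cyclic module `J / J_{n-1}` and its annihilator -/

section GradientQuotient

variable (k : Type*) [Field k] {n : ℕ}

theorem tailIdeal_eq (hn : 1 ≤ n) :
    tailIdeal k n = Ideal.span {subdiag k n, diag k n 1 ^ (n - 1)} := by
  rw [tailIdeal, subdiag, Ideal.span_insert_neg, diag, if_pos hn]

theorem lastPartial_mem_gradientIdeal (hn : 1 ≤ n) :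
    lastPartial (subdiag k n) (diag k n) (n - 1) ∈ gradientIdeal k n := by
  rw [gradientIdeal_eq k hn]
  exact Ideal.mem_sup_right (Ideal.mem_span_singleton_self _)

/-- The class of the last partial derivative in `J / J_{n-1}`. -/
def lastClass (hn : 1 ≤ n) : gradientQuotient k n :=
  ⟨Submodule.mkQ _ (lastPartial (subdiag k n) (diag k n) (n - 1)),
    Submodule.mem_map_of_mem (lastPartial_mem_gradientIdeal k hn)⟩

/-- Multiplication of scalars with the class of the last partial derivative. -/
def mulLastClass (hn : 1 ≤ n) : MvPolynomial (Fin (n + 1)) k →ₗ[MvPolynomial (Fin (n + 1)) k]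
    gradientQuotient k n :=
  LinearMap.toSpanSingleton _ _ (lastClass k hn)

theorem coe_mulLastClass (hn : 1 ≤ n) (u : MvPolynomial (Fin (n + 1)) k) :
    (mulLastClass k hn u : MvPolynomial (Fin (n + 1)) k ⧸ subgradientIdeal k n) =
      Submodule.mkQ _ (u * lastPartial (subdiag k n) (diag k n) (n - 1)) := rfl

theorem mulLastClass_surjective (hn : 1 ≤ n) : Function.Surjective (mulLastClass k hn) := by
  rintro ⟨x, y, hy, rfl⟩
  have hy' : y ∈ gradientIdeal k n := hy
  rw [gradientIdeal_eq k hn] at hy'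
  obtain ⟨z, hz, w, hw, rfl⟩ := Submodule.mem_sup.1 hy'
  obtain ⟨u, rfl⟩ := Ideal.mem_span_singleton'.1 hw
  refine ⟨u, Subtype.ext ?_⟩
  rw [coe_mulLastClass]
  refine ((Submodule.Quotient.eq _).2 ?_).symm
  rw [add_sub_cancel_right, subgradientIdeal_eq k hn]
  exact hz

theorem mulLastClass_eq_zero_iff_mul_mem (hn : 1 ≤ n) (u : MvPolynomial (Fin (n + 1)) k) :
    mulLastClass k hn u = 0 ↔ u * lastPartial (subdiag k n) (diag k n) (n - 1) ∈
      tailPartialIdeal (subdiag k n) (diag k n) n := by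
  rw [← subgradientIdeal_eq k hn, ← Submodule.coe_eq_zero, coe_mulLastClass]
  exact Submodule.Quotient.mk_eq_zero _

variable [CharZero k]

theorem mul_lastPartial_mem_iff (hn : 2 ≤ n) (u : MvPolynomial (Fin (n + 1)) k) :
    u * lastPartial (subdiag k n) (diag k n) (n - 1) ∈
      tailPartialIdeal (subdiag k n) (diag k n) n ↔ u ∈ tailIdeal k n := by
  rw [tailIdeal_eq k (by omega)]
  obtain ⟨m, rfl⟩ : ∃ m, n = m + 2 := ⟨n - 2, by omega⟩
  exact ⟨mem_span_of_mul_lastPartial_mem subdiag_mul_eq_zero (mem_span_subdiag (by omega))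
    isUnit_natCast_succ (mem_span_subdiag_pair hn) m,
    mul_lastPartial_mem_of_mem_span isUnit_natCast_succ (m + 1)⟩

theorem mulLastClass_eq_zero_iff (hn : 2 ≤ n) (u : MvPolynomial (Fin (n + 1)) k) :
    mulLastClass k (by omega) u = 0 ↔ u ∈ tailIdeal k n := by
  rw [mulLastClass_eq_zero_iff_mul_mem, mul_lastPartial_mem_iff k hn]

theorem ker_mulLastClass (hn : 2 ≤ n) :
    LinearMap.ker (mulLastClass k (n := n) (by omega)) = tailIdeal k n := by
  ext u
  rw [LinearMap.mem_ker, mulLastClass_eq_zero_iff k hn]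

/-- The isomorphism `R ⧸ (x_n, x_{n-1}^{n-1}) ≃ J / J_{n-1}`. -/
def tailQuotientEquiv (hn : 2 ≤ n) : (MvPolynomial (Fin (n + 1)) k ⧸ tailIdeal k n)
    ≃ₗ[MvPolynomial (Fin (n + 1)) k] gradientQuotient k n :=
  (Submodule.quotEquivOfEq _ _ (ker_mulLastClass k hn).symm).trans
    ((mulLastClass k (by omega)).quotKerEquivOfSurjective (mulLastClass_surjective k _))

end GradientQuotient

/-! ### The Hilbert–Burch and Koszul maps -/

section Complexes

theorem mem_freeGrading_of_isHomogeneous {k σ ι : Type*} [Field k] {t : ι → ℕ} {j : ℕ}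
    {v : ι → MvPolynomial σ k} (h : ∀ i, t i ≤ j ∧ (v i).IsHomogeneous (j - t i)) :
    v ∈ freeGrading t j :=
  mem_freeGrading.2 fun i => by
    rw [if_pos (h i).1]
    exact (h i).2

variable (k : Type*) [Field k] (n : ℕ)

/-- The row of the partial derivatives with respect to `x_0, …, x_{n-1}`. -/
def partialRow : (Fin n → MvPolynomial (Fin (n + 1)) k) →ₗ[MvPolynomial (Fin (n + 1)) k]
    (Fin 1 → MvPolynomial (Fin (n + 1)) k) :=
  Fintype.linearCombination _ fun p _ => tailPartial (subdiag k n) (diag k n) n p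

/-- The matrix of linear syzygies of the partial derivatives. -/
def syzygyMatrix : (Fin (n - 1) → MvPolynomial (Fin (n + 1)) k) →ₗ[MvPolynomial (Fin (n + 1)) k]
    (Fin n → MvPolynomial (Fin (n + 1)) k) :=
  Fintype.linearCombination _ fun q p => linearSyzygy (subdiag k n) (diag k n) (q + 1) p

/-- The generators of `(x_n, x_{n-1}^{n-1})`. -/
def koszulRow : (Fin 2 → MvPolynomial (Fin (n + 1)) k) →ₗ[MvPolynomial (Fin (n + 1)) k]
    (Fin 1 → MvPolynomial (Fin (n + 1)) k) :=
  Fintype.linearCombination _ ![fun _ => subdiag k n, fun _ => diag k n 1 ^ (n - 1)]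

/-- The Koszul relation between the generators of `(x_n, x_{n-1}^{n-1})`. -/
def koszulColumn : (Fin 1 → MvPolynomial (Fin (n + 1)) k) →ₗ[MvPolynomial (Fin (n + 1)) k]
    (Fin 2 → MvPolynomial (Fin (n + 1)) k) :=
  Fintype.linearCombination _ fun _ => ![diag k n 1 ^ (n - 1), -subdiag k n]

variable {k n}

theorem partialRow_apply (v : Fin n → MvPolynomial (Fin (n + 1)) k) (i : Fin 1) :
    partialRow k n v i = ∑ p, v p * tailPartial (subdiag k n) (diag k n) n p := by
  simp [partialRow, Fintype.linearCombination_apply]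

theorem syzygyMatrix_apply (v : Fin (n - 1) → MvPolynomial (Fin (n + 1)) k) (p : Fin n) :
    syzygyMatrix k n v p = ∑ q, v q * linearSyzygy (subdiag k n) (diag k n) (q + 1) p := by
  simp [syzygyMatrix, Fintype.linearCombination_apply]

theorem koszulRow_apply (v : Fin 2 → MvPolynomial (Fin (n + 1)) k) (i : Fin 1) :
    koszulRow k n v i = v 0 * subdiag k n + v 1 * diag k n 1 ^ (n - 1) := by
  simp [koszulRow, Fintype.linearCombination_apply]

theorem koszulColumn_apply (v : Fin 1 → MvPolynomial (Fin (n + 1)) k) :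
    koszulColumn k n v = ![v 0 * diag k n 1 ^ (n - 1), -(v 0 * subdiag k n)] := by
  funext i
  fin_cases i <;> simp [koszulColumn, Fintype.linearCombination_apply]

theorem exists_partialRow_eq_iff (x : MvPolynomial (Fin (n + 1)) k) :
    (∃ v, partialRow k n v = fun _ => x) ↔ x ∈ tailPartialIdeal (subdiag k n) (diag k n) n := by
  rw [tailPartialIdeal, Ideal.mem_span_range_iff_exists_fun]
  refine exists_congr fun v => ?_
  rw [funext_iff]
  simp [partialRow_apply]

theorem partialRow_graded (j : ℕ) (v : Fin n → MvPolynomial (Fin (n + 1)) k)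
    (hv : v ∈ freeGrading (fun _ => n - 1) j) : partialRow k n v ∈ freeGrading (fun _ => 0) j := by
  refine linearCombination_mem_freeGrading (fun p => mem_freeGrading.2 fun _ => ?_) j v hv
  rw [if_pos (Nat.zero_le _)]
  exact isHomogeneous_tailPartial (isHomogeneous_subdiag k n) (isHomogeneous_diag k n) p.2

theorem syzygyMatrix_graded (j : ℕ) (v : Fin (n - 1) → MvPolynomial (Fin (n + 1)) k)
    (hv : v ∈ freeGrading (fun _ => n) j) :
    syzygyMatrix k n v ∈ freeGrading (fun _ => n - 1) j := by
  refine linearCombination_mem_freeGrading (fun q => mem_freeGrading.2 fun p => ?_) j v hv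
  rw [if_pos (Nat.sub_le _ _), show n - (n - 1) = 1 by have := p.2; omega]
  exact isHomogeneous_linearSyzygy (isHomogeneous_subdiag k n) (isHomogeneous_diag k n) _ _

theorem koszulRow_graded (hn : 1 ≤ n) (j : ℕ) (v : Fin 2 → MvPolynomial (Fin (n + 1)) k)
    (hv : v ∈ freeGrading ![n, 2 * (n - 1)] j) :
    koszulRow k n v ∈ freeGrading (fun _ => n - 1) j := by
  refine linearCombination_mem_freeGrading (Fin.forall_fin_two.2
    ⟨mem_freeGrading_of_isHomogeneous fun p => ⟨?_, ?_⟩,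
      mem_freeGrading_of_isHomogeneous fun p => ⟨?_, ?_⟩⟩) j v hv
  · exact Nat.sub_le n 1
  · change (subdiag k n).IsHomogeneous (n - (n - 1))
    rw [show n - (n - 1) = 1 by omega]
    exact isHomogeneous_subdiag k n
  · change n - 1 ≤ 2 * (n - 1)
    omega
  · change (diag k n 1 ^ (n - 1)).IsHomogeneous (2 * (n - 1) - (n - 1))
    rw [show 2 * (n - 1) - (n - 1) = 1 * (n - 1) by omega]
    exact (isHomogeneous_diag k n 1).pow _

theorem koszulColumn_graded (hn : 1 ≤ n) (j : ℕ) (v : Fin 1 → MvPolynomial (Fin (n + 1)) k)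
    (hv : v ∈ freeGrading (fun _ => 2 * n - 1) j) :
    koszulColumn k n v ∈ freeGrading ![n, 2 * (n - 1)] j := by
  refine linearCombination_mem_freeGrading (fun q => mem_freeGrading_of_isHomogeneous
    (Fin.forall_fin_two.2 ⟨⟨?_, ?_⟩, ⟨?_, ?_⟩⟩)) j v hv
  · change n ≤ 2 * n - 1
    omega
  · change (diag k n 1 ^ (n - 1)).IsHomogeneous (2 * n - 1 - n)
    rw [show 2 * n - 1 - n = 1 * (n - 1) by omega]
    exact (isHomogeneous_diag k n 1).pow _
  · change 2 * (n - 1) ≤ 2 * n - 1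
    omega
  · change (-subdiag k n).IsHomogeneous (2 * n - 1 - 2 * (n - 1))
    rw [show 2 * n - 1 - 2 * (n - 1) = 1 by omega]
    exact (isHomogeneous_subdiag k n).neg

theorem partialRow_syzygyMatrix (v : Fin (n - 1) → MvPolynomial (Fin (n + 1)) k) :
    partialRow k n (syzygyMatrix k n v) = 0 := by
  funext i
  simp only [partialRow_apply, syzygyMatrix_apply, Finset.sum_mul, mul_assoc]
  rw [Finset.sum_comm]
  refine Finset.sum_eq_zero fun q _ => ?_
  rw [← Finset.mul_sum, ← Finset.sum_range fun p => linearSyzygy (subdiag k n) (diag k n) (q + 1) p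
    * tailPartial (subdiag k n) (diag k n) n p, sum_linearSyzygy_eq_zero _ _
    (by have := q.2; omega), mul_zero]

theorem koszulRow_koszulColumn (v : Fin 1 → MvPolynomial (Fin (n + 1)) k) :
    koszulRow k n (koszulColumn k n v) = 0 := by
  funext i
  rw [koszulRow_apply, koszulColumn_apply]
  simp
  ring

theorem koszulColumn_injective : Function.Injective (koszulColumn k n) := by
  rw [← LinearMap.ker_eq_bot, LinearMap.ker_eq_bot']
  intro v hv
  have h := congrFun hv 1
  rw [koszulColumn_apply] at h
  funext i
  obtain rfl : i = 0 := Subsingleton.elim _ _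
  refine subdiag_mul_eq_zero _ ?_
  rw [mul_comm]
  simpa using h

theorem koszul_exact (hn : 1 ≤ n) : Function.Exact (koszulColumn k n) (koszulRow k n) := by
  intro v
  refine ⟨fun hv => ?_, fun ⟨w, hw⟩ => hw ▸ koszulRow_koszulColumn w⟩
  have h := congrFun hv 0
  rw [koszulRow_apply, Pi.zero_apply] at h
  have h1 : v 1 ∈ Ideal.span {subdiag k n} := by
    refine pow_mul_mem_span (mem_span_subdiag hn) (n - 1) ?_
    rw [Ideal.mem_span_singleton']
    exact ⟨-v 0, by linear_combination -h⟩
  obtain ⟨y, hy⟩ := Ideal.mem_span_singleton'.1 h1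
  refine ⟨fun _ => -y, ?_⟩
  rw [koszulColumn_apply]
  funext i
  fin_cases i
  · have : -y * diag k n 1 ^ (n - 1) - v 0 = 0 := by
      apply subdiag_mul_eq_zero
      linear_combination -h - diag k n 1 ^ (n - 1) * hy
    simpa using sub_eq_zero.1 this
  · simpa using hy

variable [CharZero k]

theorem syzygyMatrix_injective (hn : 1 ≤ n) : Function.Injective (syzygyMatrix k n) := by
  obtain ⟨m, rfl⟩ : ∃ m, n = m + 1 := ⟨n - 1, by omega⟩
  rw [← LinearMap.ker_eq_bot, LinearMap.ker_eq_bot']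
  intro v hv
  have h := eq_zero_of_sum_linearSyzygy (b := subdiag k (m + 1)) (a := diag k (m + 1))
    subdiag_mul_eq_zero (N := m)
    (fun q => if hq : q < m then v ⟨q, hq⟩ else 0) isUnit_natCast_succ (fun p hp => by
      have := congrFun hv ⟨p, hp⟩
      rw [syzygyMatrix_apply] at this
      rw [Finset.sum_range]
      simpa using this)
  funext q
  exact (dif_pos (show (q : ℕ) < m from q.2)).symm.trans (h q q.2)

theorem syzygy_exact (hn : 1 ≤ n) : Function.Exact (syzygyMatrix k n) (partialRow k n) := by
  obtain ⟨m, rfl⟩ : ∃ m, n = m + 1 := ⟨n - 1, by omega⟩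
  intro v
  refine ⟨fun hv => ?_, fun ⟨w, hw⟩ => hw ▸ partialRow_syzygyMatrix w⟩
  have h := congrFun hv 0
  rw [partialRow_apply, Pi.zero_apply] at h
  obtain ⟨d, hd⟩ := exists_eq_sum_linearSyzygy (b := subdiag k (m + 1)) (a := diag k (m + 1))
    subdiag_mul_eq_zero (mem_span_subdiag hn) isUnit_natCast_succ (N := m)
    (fun p => if hp : p < m + 1 then v ⟨p, hp⟩ else 0) (by
      rw [Finset.sum_range]
      refine (Finset.sum_congr rfl fun p _ => ?_).trans h
      rw [dif_pos p.2])
  refine ⟨fun q => d q, funext fun p => ?_⟩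
  rw [syzygyMatrix_apply]
  have h2 := hd p p.2
  rw [dif_pos p.2, Finset.sum_range] at h2
  exact h2.symm

end Complexes

/-! ### Compatibility of the isomorphism with the gradings -/

section GradedIsomorphism

variable {k : Type*} [Field k] {n : ℕ}

theorem mem_quotientGrading {σ : Type*} {I : Ideal (MvPolynomial σ k)} {j : ℕ}
    {x : MvPolynomial σ k ⧸ I} :
    x ∈ quotientGrading I j ↔ ∃ v : MvPolynomial σ k, v.IsHomogeneous j ∧ Ideal.Quotient.mk I v = x :=
  Iff.rfl

variable (k n) in
/-- Multiplication with the last partial derivative. -/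
def lastColumn : (Fin 1 → MvPolynomial (Fin (n + 1)) k) →ₗ[MvPolynomial (Fin (n + 1)) k]
    (Fin 1 → MvPolynomial (Fin (n + 1)) k) :=
  Fintype.linearCombination _ fun _ _ => lastPartial (subdiag k n) (diag k n) (n - 1)

theorem lastColumn_apply (v : Fin 1 → MvPolynomial (Fin (n + 1)) k) (i : Fin 1) :
    lastColumn k n v i = v 0 * lastPartial (subdiag k n) (diag k n) (n - 1) := by
  simp [lastColumn, Fintype.linearCombination_apply]

theorem lastColumn_graded (j : ℕ) (v : Fin 1 → MvPolynomial (Fin (n + 1)) k)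
    (hv : v ∈ freeGrading (fun _ => n - 1) j) : lastColumn k n v ∈ freeGrading (fun _ => 0) j :=
  linearCombination_mem_freeGrading (fun _ => mem_freeGrading_of_isHomogeneous fun _ =>
    ⟨Nat.zero_le _, isHomogeneous_lastPartial (isHomogeneous_subdiag k n)
      (isHomogeneous_diag k n) _⟩) j v hv

theorem homogeneousComponent_mul_lastPartial (j : ℕ) (u : MvPolynomial (Fin (n + 1)) k) :
    homogeneousComponent j (u * lastPartial (subdiag k n) (diag k n) (n - 1)) =
      (if n - 1 ≤ j then homogeneousComponent (j - (n - 1)) u else 0) *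
        lastPartial (subdiag k n) (diag k n) (n - 1) := by
  have h := congrFun (freeComponent_comm (lastColumn k n) lastColumn_graded j fun _ => u) 0
  rw [freeComponent_apply, lastColumn_apply, lastColumn_apply, freeComponent_apply,
    if_pos (Nat.zero_le _)] at h
  exact h

theorem homogeneousComponent_mem_tailPartialIdeal (j : ℕ) {x : MvPolynomial (Fin (n + 1)) k}
    (hx : x ∈ tailPartialIdeal (subdiag k n) (diag k n) n) :
    homogeneousComponent j x ∈ tailPartialIdeal (subdiag k n) (diag k n) n := by
  obtain ⟨v, hv⟩ := (exists_partialRow_eq_iff x).2 hx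
  refine (exists_partialRow_eq_iff _).1 ⟨freeComponent (fun _ => n - 1) j v, ?_⟩
  rw [← freeComponent_comm (partialRow k n) partialRow_graded, hv]
  funext i
  rw [freeComponent_apply, if_pos (Nat.zero_le _)]
  rfl

variable [CharZero k]

theorem mem_shiftGrading_iff_tailQuotientEquiv_mem (hn : 2 ≤ n) (j : ℕ)
    (x : MvPolynomial (Fin (n + 1)) k ⧸ tailIdeal k n) :
    x ∈ shiftGrading (quotientGrading (tailIdeal k n)) (n - 1) j ↔
      tailQuotientEquiv k hn x ∈ submoduleGrading (gradientQuotient k n) j := by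
  obtain ⟨u, rfl⟩ := Ideal.Quotient.mk_surjective x
  have h1 : tailQuotientEquiv k hn (Ideal.Quotient.mk _ u) ∈
      submoduleGrading (gradientQuotient k n) j ↔ ∃ v : MvPolynomial (Fin (n + 1)) k,
        v.IsHomogeneous j ∧ v - u * lastPartial (subdiag k n) (diag k n) (n - 1) ∈
          tailPartialIdeal (subdiag k n) (diag k n) n := by
    rw [← subgradientIdeal_eq k (by omega)]
    exact exists_congr fun v => and_congr_right fun _ => Ideal.Quotient.eq
  rw [h1, shiftGrading]
  constructor
  · intro h
    by_cases hj : n - 1 ≤ j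
    · rw [if_pos hj, mem_quotientGrading] at h
      obtain ⟨u', hu', he⟩ := h
      refine ⟨u' * lastPartial (subdiag k n) (diag k n) (n - 1), ?_, ?_⟩
      · have h2 := hu'.mul (isHomogeneous_lastPartial (isHomogeneous_subdiag k n)
          (isHomogeneous_diag k n) (n - 1))
        rwa [Nat.sub_add_cancel hj] at h2
      · rw [← sub_mul, mul_lastPartial_mem_iff k hn]
        exact Ideal.Quotient.eq.1 he
    · rw [if_neg hj, Submodule.mem_bot, Ideal.Quotient.eq_zero_iff_mem] at h
      refine ⟨0, isHomogeneous_zero _ _ _, ?_⟩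
      rw [zero_sub]
      exact neg_mem ((mul_lastPartial_mem_iff k hn u).2 h)
  · rintro ⟨v, hv, hvu⟩
    -- Comparing `v - u G` with its component of degree `j` shows that `u` minus its component of
    -- degree `j - (n - 1)` (zero if `j < n - 1`) annihilates `G` modulo `J_{n-1}`.
    have h2 := homogeneousComponent_mem_tailPartialIdeal j hvu
    rw [map_sub, homogeneousComponent_mul_lastPartial, homogeneousComponent_of_mem hv,
      if_pos rfl] at h2
    have h3 := sub_mem h2 hvu
    rw [sub_sub_sub_cancel_left, ← sub_mul, mul_lastPartial_mem_iff k hn] at h3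
    by_cases hj : n - 1 ≤ j
    · rw [if_pos hj] at h3 ⊢
      rw [mem_quotientGrading]
      refine ⟨_, homogeneousComponent_isHomogeneous _ u, (Ideal.Quotient.eq.2 h3).symm⟩
    · rw [if_neg hj] at h3 ⊢
      rw [Submodule.mem_bot, Ideal.Quotient.eq_zero_iff_mem]
      simpa using h3

end GradedIsomorphism

/-! ### The resolutions, the lift, its cone, and the linear rank -/

section Resolutions

variable (k : Type*) [Field k] {n : ℕ}

/-- The Koszul resolution of `R ⧸ (x_n, x_{n-1}^{n-1})`, shifted by `n - 1`. -/
def koszulComplex (hn : 1 ≤ n) : GradedFreeComplex k (Fin (n + 1)) :=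
  .ofTwoMaps (fun _ : Fin 1 => n - 1) ![n, 2 * (n - 1)] (fun _ : Fin 1 => 2 * n - 1)
    (koszulRow k n) (koszulColumn k n) (koszulRow_graded hn) (koszulColumn_graded hn)
    koszulRow_koszulColumn

variable (n) in
/-- The Hilbert–Burch resolution of `R ⧸ J_{n-1}`. -/
def hilbertBurchComplex : GradedFreeComplex k (Fin (n + 1)) :=
  .ofTwoMaps (fun _ : Fin 1 => 0) (fun _ : Fin n => n - 1) (fun _ : Fin (n - 1) => n)
    (partialRow k n) (syzygyMatrix k n) partialRow_graded syzygyMatrix_graded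
    partialRow_syzygyMatrix

theorem koszulComplex_twists_zero (hn : 1 ≤ n) : (koszulComplex k hn).twists 0 = {n - 1} := rfl

theorem koszulComplex_twists_one (hn : 1 ≤ n) :
    (koszulComplex k hn).twists 1 = {n, 2 * (n - 1)} := rfl

theorem koszulComplex_twists_two (hn : 1 ≤ n) :
    (koszulComplex k hn).twists 2 = {2 * n - 1} := rfl

theorem koszulComplex_twists_of_le (hn : 1 ≤ n) (i : ℕ) (hi : 3 ≤ i) :
    (koszulComplex k hn).twists i = 0 := by
  obtain ⟨i, rfl⟩ := Nat.exists_eq_add_of_le' hi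
  rfl

theorem hilbertBurchComplex_twists_zero : (hilbertBurchComplex k n).twists 0 = {0} := rfl

theorem hilbertBurchComplex_twists_one :
    (hilbertBurchComplex k n).twists 1 = Multiset.replicate n (n - 1) := by
  change (Finset.univ : Finset (Fin n)).val.map (fun _ => n - 1) = _
  simp

theorem hilbertBurchComplex_twists_two :
    (hilbertBurchComplex k n).twists 2 = Multiset.replicate (n - 1) n := by
  change (Finset.univ : Finset (Fin (n - 1))).val.map (fun _ => n) = _
  simp

theorem hilbertBurchComplex_twists_of_le (i : ℕ) (hi : 3 ≤ i) :
    (hilbertBurchComplex k n).twists i = 0 := by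
  obtain ⟨i, rfl⟩ := Nat.exists_eq_add_of_le' hi
  rfl

/-- The augmentation of the Koszul complex. -/
def koszulAug (hn : 1 ≤ n) : ((koszulComplex k hn).ι 0 → MvPolynomial (Fin (n + 1)) k)
    →ₗ[MvPolynomial (Fin (n + 1)) k] gradientQuotient k n :=
  mulLastClass k hn ∘ₗ
    (LinearMap.proj 0 : (Fin 1 → MvPolynomial (Fin (n + 1)) k) →ₗ[MvPolynomial (Fin (n + 1)) k] _)

variable (n) in
/-- The augmentation of the Hilbert–Burch complex. -/
def hilbertBurchAug : ((hilbertBurchComplex k n).ι 0 → MvPolynomial (Fin (n + 1)) k)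
    →ₗ[MvPolynomial (Fin (n + 1)) k] MvPolynomial (Fin (n + 1)) k ⧸ subgradientIdeal k n :=
  Submodule.mkQ (subgradientIdeal k n) ∘ₗ
    (LinearMap.proj 0 : (Fin 1 → MvPolynomial (Fin (n + 1)) k) →ₗ[MvPolynomial (Fin (n + 1)) k] _)

variable [CharZero k]

theorem koszulComplex_isMinimalResolution (hn : 2 ≤ n) :
    (koszulComplex k (n := n) (by omega)).IsMinimalResolution
      (submoduleGrading (gradientQuotient k n)) (koszulAug k (by omega)) := by
  refine GradedFreeComplex.ofTwoMaps_isMinimalResolution ?_ ?_ ?_ (koszul_exact (by omega))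
    koszulColumn_injective ?_ ?_
  · intro j v hv
    refine mem_quotientGrading.2 ⟨v 0 * lastPartial (subdiag k n) (diag k n) (n - 1), ?_, rfl⟩
    have h := mem_freeGrading.1 (lastColumn_graded j v hv) 0
    rw [if_pos (Nat.zero_le _), lastColumn_apply] at h
    exact h
  · intro x
    obtain ⟨u, hu⟩ := mulLastClass_surjective k (by omega) x
    exact ⟨fun _ => u, hu⟩
  · intro v
    refine (mulLastClass_eq_zero_iff k hn (v 0)).trans ?_
    rw [tailIdeal_eq k (by omega), Ideal.mem_span_pair]
    constructor
    · rintro ⟨y, z, h⟩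
      refine ⟨![y, z], funext fun i => ?_⟩
      obtain rfl : i = 0 := Subsingleton.elim _ _
      rw [koszulRow_apply]
      exact h
    · rintro ⟨w, rfl⟩
      exact ⟨w 0, w 1, (koszulRow_apply w 0).symm⟩
  · rw [Fin.forall_fin_two]
    refine ⟨fun _ => ?_, fun _ => ?_⟩
    · change n - 1 < n
      omega
    · change n - 1 < 2 * (n - 1)
      omega
  · refine fun _ => Fin.forall_fin_two.2 ⟨?_, ?_⟩
    · change n < 2 * n - 1
      omega
    · change 2 * (n - 1) < 2 * n - 1
      omega

theorem hilbertBurchComplex_isMinimalResolution (hn : 2 ≤ n) :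
    (hilbertBurchComplex k n).IsMinimalResolution
      (quotientGrading (subgradientIdeal k n)) (hilbertBurchAug k n) := by
  refine GradedFreeComplex.ofTwoMaps_isMinimalResolution ?_ ?_ ?_ (syzygy_exact (by omega))
    (syzygyMatrix_injective (by omega)) ?_ ?_
  · intro j v hv
    refine mem_quotientGrading.2 ⟨v 0, ?_, rfl⟩
    have h := mem_freeGrading.1 hv 0
    rwa [if_pos (Nat.zero_le _)] at h
  · intro x
    obtain ⟨u, hu⟩ := Submodule.mkQ_surjective _ x
    exact ⟨fun _ => u, hu⟩
  · intro v
    refine (Submodule.Quotient.mk_eq_zero (subgradientIdeal k n) (x := v 0)).trans ?_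
    rw [subgradientIdeal_eq k (by omega), ← exists_partialRow_eq_iff]
    refine exists_congr fun w => ?_
    rw [show (fun _ => v 0) = v from funext fun i => congrArg v (Subsingleton.elim _ _)]
  · intro _ _
    omega
  · intro _ _
    omega

theorem exists_lift (hn : 2 ≤ n) :
    ∃ g : GradedFreeComplex.Hom (koszulComplex k (n := n) (by omega)) (hilbertBurchComplex k n),
      g.f 0 = lastColumn k n := by
  have hG : ∀ u ∈ tailIdeal k n, ∃ v, partialRow k n v =
      fun _ => u * lastPartial (subdiag k n) (diag k n) (n - 1) := fun u hu =>
    (exists_partialRow_eq_iff _).2 ((mul_lastPartial_mem_iff k hn u).2 hu)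
  have hmem : ∀ (u : MvPolynomial (Fin (n + 1)) k) (d : ℕ), u.IsHomogeneous d →
      (fun _ => u * lastPartial (subdiag k n) (diag k n) (n - 1)) ∈
        freeGrading (fun _ : Fin 1 => 0) (d + (n - 1)) := fun u d hu =>
    mem_freeGrading_of_isHomogeneous fun _ => ⟨Nat.zero_le _,
      hu.mul (isHomogeneous_lastPartial (isHomogeneous_subdiag k n) (isHomogeneous_diag k n) _)⟩
  -- The two generators of the annihilator of `G` yield homogeneous expressions `z₀`, `z₁` of their
  -- multiples of `G` in the other partials: the columns of the lift in degree one.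
  obtain ⟨z₀, hz₀, e₀⟩ := exists_mem_freeGrading_of_mem_range (partialRow k n) partialRow_graded
    (hmem (subdiag k n) 1 (isHomogeneous_subdiag k n)) (hG _ (by
      rw [tailIdeal_eq k (by omega)]
      exact Ideal.subset_span (by simp)))
  obtain ⟨z₁, hz₁, e₁⟩ := exists_mem_freeGrading_of_mem_range (partialRow k n) partialRow_graded
    (hmem (diag k n 1 ^ (n - 1)) _ ((isHomogeneous_diag k n 1).pow (n - 1))) (hG _ (by
      rw [tailIdeal_eq k (by omega)]
      exact Ideal.subset_span (by simp)))
  let f₁ := Fintype.linearCombination (MvPolynomial (Fin (n + 1)) k) ![z₀, z₁]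
  have hf₁ : ∀ v, f₁ v = v 0 • z₀ + v 1 • z₁ := fun v => by
    simp [f₁, Fintype.linearCombination_apply]
  have hf₁gr : ∀ j, ∀ v ∈ freeGrading ![n, 2 * (n - 1)] j,
      f₁ v ∈ freeGrading (fun _ => n - 1) j := by
    refine linearCombination_mem_freeGrading (Fin.forall_fin_two.2 ⟨?_, ?_⟩)
    · rw [show 1 + (n - 1) = n by omega] at hz₀
      exact hz₀
    · rw [show 1 * (n - 1) + (n - 1) = 2 * (n - 1) by omega] at hz₁
      exact hz₁
  have hc₀ : ∀ v, partialRow k n (f₁ v) = lastColumn k n (koszulRow k n v) := by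
    intro v
    funext i
    rw [hf₁, map_add, map_smul, map_smul, e₀, e₁, lastColumn_apply, koszulRow_apply]
    simp
    ring
  -- The image of the Koszul relation is a syzygy of the partials, hence a combination of linear
  -- syzygies.
  obtain ⟨w, hw, ew⟩ := exists_mem_freeGrading_of_mem_range (syzygyMatrix k n)
    syzygyMatrix_graded (hf₁gr _ _ (koszulColumn_graded (by omega) _ _
      (single_mem_freeGrading (fun _ : Fin 1 => 2 * n - 1) 0)))
    ((syzygy_exact (by omega) _).1 (by rw [hc₀, koszulRow_koszulColumn, map_zero]))
  refine ⟨GradedFreeComplex.homOfThreeMaps (lastColumn k n) f₁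
    (Fintype.linearCombination _ fun _ : Fin 1 => w) lastColumn_graded hf₁gr
    (linearCombination_mem_freeGrading fun _ => hw) hc₀ ?_, rfl⟩
  intro v
  rw [Fintype.linearCombination_apply, Fin.sum_univ_one, map_smul, ew, ← map_smul, ← map_smul]
  congr 2
  funext i
  obtain rfl : i = 0 := Subsingleton.elim _ _
  simp

omit [CharZero k] in
theorem projection_surjective : Function.Surjective (projection k n) :=
  Submodule.factor_surjective (subgradientIdeal_le k n)

omit [CharZero k] in
theorem exact_subtype_projection :
    Function.Exact (gradientQuotient k n).subtype (projection k n) := by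
  intro x
  obtain ⟨u, rfl⟩ := Submodule.mkQ_surjective _ x
  constructor
  · intro h
    have hu : u ∈ gradientIdeal k n := (Submodule.Quotient.mk_eq_zero _).1 h
    exact ⟨⟨_, Submodule.mem_map_of_mem hu⟩, rfl⟩
  · rintro ⟨⟨_, y, hy, rfl⟩, h⟩
    rw [← h]
    exact (Submodule.Quotient.mk_eq_zero (gradientIdeal k n)).2 hy

omit [CharZero k] in
theorem hilbertBurchAug_lift (hn : 1 ≤ n)
    (g : GradedFreeComplex.Hom (koszulComplex k hn) (hilbertBurchComplex k n))
    (hg : g.f 0 = lastColumn k n) (v) :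
    hilbertBurchAug k n (g.f 0 v) = (gradientQuotient k n).subtype (koszulAug k hn v) := by
  rw [hg]
  exact congrArg (Submodule.mkQ (subgradientIdeal k n)) (lastColumn_apply v 0)

theorem cone_isMinimalResolution (hn : 2 ≤ n)
    (g : GradedFreeComplex.Hom (koszulComplex k (n := n) (by omega)) (hilbertBurchComplex k n))
    (hg : g.f 0 = lastColumn k n) :
    g.cone.IsMinimalResolution (quotientGrading (gradientIdeal k n))
      (projection k n ∘ₗ hilbertBurchAug k n) := by
  refine g.cone_isMinimalResolution (koszulComplex_isMinimalResolution k hn)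
    (hilbertBurchComplex_isMinimalResolution k hn) (gradientQuotient k n).subtype
    Subtype.val_injective (projection k n) (projection_surjective k)
    (exact_subtype_projection k) (hilbertBurchAug_lift k _ g hg) ?_ ?_ ?_ ?_ ?_
  · rintro j _ ⟨v, hv, rfl⟩
    exact ⟨v, hv, rfl⟩
  · rintro (_ | _ | _ | i) a b
    · change 0 < n - 1
      omega
    · revert a
      refine Fin.forall_fin_two.2 ⟨?_, ?_⟩
      · change n - 1 < n
        omega
      · change n - 1 < 2 * (n - 1)
        omega
    · change n < 2 * n - 1
      omega
    · exact Empty.elim a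
  · rintro (_ | _ | i) a b
    · change 0 < n - 1
      omega
    · change n - 1 < n
      omega
    · exact Empty.elim a
  · rintro (_ | _ | i) a b
    · revert a
      refine Fin.forall_fin_two.2 ⟨?_, ?_⟩
      · change n - 1 < n
        omega
      · change n - 1 < 2 * (n - 1)
        omega
    · revert b
      refine Fin.forall_fin_two.2 ⟨?_, ?_⟩
      · change n < 2 * n - 1
        omega
      · change 2 * (n - 1) < 2 * n - 1
        omega
    · exact Empty.elim a
  · rintro (_ | i) a b
    · change n - 1 < n
      omega
    · exact Empty.elim a

omit [CharZero k] in
theorem linearRank_cone_le (hn : 1 ≤ n)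
    (g : GradedFreeComplex.Hom (koszulComplex k hn) (hilbertBurchComplex k n)) (s : ℕ) :
    g.cone.linearRank s ≤ g.cone.presentationRank := by
  let _ := g.cone.finite 1
  refine Submodule.finrank_mono ?_
  rintro _ ⟨v, _, rfl⟩
  exact ⟨v, rfl⟩

omit [CharZero k] in
-- The first differential is nonzero because it contains `∂f/∂x_0`, up to sign a power of `x_n`;
-- rank–nullity then removes one from `n + 1`.
theorem presentationRank_cone_le (hn : 1 ≤ n)
    (g : GradedFreeComplex.Hom (koszulComplex k hn) (hilbertBurchComplex k n)) :
    g.cone.presentationRank ≤ n := by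
  have h := finrank_range_lt (ι := Fin n ⊕ Fin 1) (κ := Fin 1) (g.cone.d 1) (g.cone.d 0)
    (g.cone.d_comp_d 0) (by
      intro h0
      have h1 := g.cone_d_zero_elim (Pi.single ⟨0, hn⟩ 1 : Fin n → MvPolynomial (Fin (n + 1)) k)
      rw [h0] at h1
      have h4 : partialRow k n (Pi.single ⟨0, hn⟩ 1) 0 = 0 := (congrFun h1 (0 : Fin 1)).symm
      rw [partialRow_apply, Finset.sum_eq_single ⟨0, hn⟩] at h4
      · simp [tailPartial, hessenbergSq_zero, subdiag] at h4
      · intro p _ hp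
        rw [Pi.single_eq_of_ne hp, zero_mul]
      · simp)
  rw [Fintype.card_sum, Fintype.card_fin, Fintype.card_fin] at h
  exact Nat.lt_succ_iff.1 h

theorem le_linearRank_cone (hn : 1 ≤ n)
    (g : GradedFreeComplex.Hom (koszulComplex k hn) (hilbertBurchComplex k n)) :
    n ≤ g.cone.linearRank (n - 1) := by
  -- `Ψ` selects the `n - 1` linear syzygies and the Koszul column of `x_n`. The summand of twist `2
  -- * (n - 1)` receives zero, so the coincidence `2 * (n - 1) = n` for `n = 2` needs no separate
  -- case.
  let Ψ : (Fin (n - 1) ⊕ Fin 1 → MvPolynomial (Fin (n + 1)) k) →ₗ[MvPolynomial (Fin (n + 1)) k]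
      (Fin (n - 1) ⊕ Fin 2 → MvPolynomial (Fin (n + 1)) k) :=
    LinearMap.pi (Sum.elim (fun q => LinearMap.proj (Sum.inl q))
      ![LinearMap.proj (Sum.inr 0), 0])
  have h := le_finrank_of_injective (κ := Fin n ⊕ Fin 1) (g.cone.linearPart (n - 1))
    (g.cone.d 1 ∘ₗ Ψ) ?_ ?_
  · rw [Fintype.card_sum, Fintype.card_fin, Fintype.card_fin, Nat.sub_add_cancel hn] at h
    exact h
  · rw [← LinearMap.ker_eq_bot, LinearMap.ker_eq_bot']
    intro v hv
    have h1 : -(koszulRow k n (fun a => Ψ v (Sum.inr a))) 0 = 0 := congrFun hv (Sum.inr 0)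
    have h2 : v (Sum.inr 0) = 0 := by
      rw [koszulRow_apply] at h1
      refine subdiag_mul_eq_zero _ ?_
      simpa [Ψ, mul_comm] using h1
    have h3 : (fun a => Ψ v (Sum.inr a)) = 0 := by
      funext i
      fin_cases i <;> simp [Ψ, h2]
    have h4 : syzygyMatrix k n (fun q => v (Sum.inl q)) = 0 := by
      refine g.d_eq_zero_of_cone_d_eq_zero (i := 0) h3 (Eq.trans (congrArg (g.cone.d 1) ?_) hv)
      exact Sum.elim_comp_inl_inr (Ψ v)
    have h5 := syzygyMatrix_injective hn (h4.trans (map_zero _).symm)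
    funext i
    rcases i with q | i
    · exact congrFun h5 q
    · obtain rfl : i = 0 := Subsingleton.elim _ _
      exact h2
  · intro v
    refine ⟨Ψ v, ?_, rfl⟩
    rintro (q | i) hi
    · exact absurd (show n = n - 1 + 1 by omega) hi
    · revert hi
      revert i
      refine Fin.forall_fin_two.2 ⟨fun hi => ?_, fun _ => ?_⟩
      · exact absurd (show n = n - 1 + 1 by omega) hi
      · exact (Submodule.mem_bot _).2 rfl

end Resolutions

/-! ### Associated primes bound the length of regular sequences -/

section DepthBound

open scoped Pointwise

variable {R : Type*} [CommRing R] [IsNoetherianRing R]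

/-- If `r ∈ 𝔪` is regular on `M` and `P ⊆ 𝔪` is an associated prime of `M`, then `M ⧸ r M` has an
associated prime strictly between `P` and `𝔪`. -/
theorem exists_associated_prime_gt {M : Type*} [AddCommGroup M] [Module R M] [Module.Finite R M]
    {𝔪 P : Ideal R} [h𝔪 : 𝔪.IsPrime] (hP : P.IsPrime) (hPm : P ≤ 𝔪) {x : M}
    (hx : P = (⊥ : Submodule R M).colon {x}) {r : R} (hr : r ∈ 𝔪) (hreg : IsSMulRegular M r) :
    ∃ Q : Ideal R, Q.IsPrime ∧ P < Q ∧ Q ≤ 𝔪 ∧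
      ∃ y : QuotSMulTop r M, Q = (⊥ : Submodule R (QuotSMulTop r M)).colon {y} := by
  have hmemP : ∀ s, s ∈ P ↔ s • x = 0 := fun s => by
    rw [hx, Submodule.mem_colon_singleton, Submodule.mem_bot]
  have hrP : r ∉ P := by
    intro h
    have hx0 : x = 0 := hreg (by simpa using (hmemP r).1 h)
    exact hP.ne_top ((Ideal.eq_top_iff_one _).2 ((hmemP 1).2 (by simp [hx0])))
  let N : Submodule R M := Submodule.torsionBySet R M P
  have hN : ∀ z, z ∈ N ↔ ∀ p ∈ P, p • z = 0 := fun z => by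
    rw [Submodule.mem_torsionBySet_iff]
    simp
  have hxN : x ∈ N := (hN x).2 fun p hp => (hmemP p).1 hp
  -- A Nakayama argument at `𝔪` without localizing: otherwise, as `N` is finitely generated, a
  -- single `t ∉ 𝔪` carries `N` into `r M`, hence into `r N` because `r` is regular.
  obtain ⟨z, hz, hzm⟩ : ∃ z ∈ N, ∀ s, s • z ∈ r • (⊤ : Submodule R M) → s ∈ 𝔪 := by
    by_contra! hcon
    choose! s hs hsm using hcon
    obtain ⟨T, hT⟩ : N.FG := IsNoetherian.noetherian N
    set t := ∏ z ∈ T, s z with ht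
    have htm : t ∉ 𝔪 := by
      rw [ht, h𝔪.prod_mem_iff]
      rintro ⟨z, hz, hzm⟩
      exact hsm z (hT ▸ Submodule.subset_span hz) hzm
    have htN : ∀ z ∈ N, ∃ y ∈ N, t • z = r • y := by
      intro z hz
      have h1 : t • z ∈ r • (⊤ : Submodule R M) := by
        rw [← hT] at hz
        induction hz using Submodule.span_induction with
        | mem z hz =>
          obtain ⟨c, hc⟩ := Finset.dvd_prod_of_mem s hz
          rw [ht, hc, mul_comm, mul_smul]
          exact Submodule.smul_mem _ _ (hs z (hT ▸ Submodule.subset_span hz))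
        | zero => simp
        | add z w _ _ hz hw => rw [smul_add]; exact add_mem hz hw
        | smul c z _ hz => rw [smul_comm]; exact Submodule.smul_mem _ _ hz
      obtain ⟨y, -, hy⟩ := (Submodule.mem_smul_pointwise_iff_exists _ _ _).1 h1
      refine ⟨y, (hN y).2 fun p hp => hreg ?_, hy.symm⟩
      simp only [smul_zero]
      rw [smul_comm, hy, smul_comm, (hN z).1 hz p hp, smul_zero]
    -- Determinant trick: a monic polynomial in `t` with lower coefficients in `(r)` kills `x ∈ N`,
    -- so its value lies in `P ⊆ 𝔪`. As `r ∈ 𝔪`, a power of `t` is in `𝔪`, a contradiction.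
    obtain ⟨p, hp, -, hcoeff, hp0⟩ :=
      LinearMap.exists_monic_and_natDegree_eq_and_coeff_mem_pow_and_aeval_eq_zero R
        (f := algebraMap R (Module.End R N) t) (I := Ideal.span {r}) (by
          rintro _ ⟨z, rfl⟩
          obtain ⟨y, hy, hzy⟩ := htN z z.2
          have : algebraMap R (Module.End R N) t z = r • (⟨y, hy⟩ : N) := Subtype.ext hzy
          rw [this]
          exact Submodule.smul_mem_smul (Ideal.mem_span_singleton_self r) trivial)
    have hev : p.eval t • x = 0 := by
      rw [Polynomial.aeval_algebraMap_apply] at hp0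
      exact congrArg Subtype.val (LinearMap.congr_fun hp0 ⟨x, hxN⟩)
    have hevm : p.eval t ∈ 𝔪 := hPm ((hmemP _).2 hev)
    refine htm (h𝔪.mem_of_pow_mem p.natDegree ?_)
    rw [Polynomial.eval_eq_sum_range, Finset.sum_range_succ, hp.coeff_natDegree, one_mul,
      Ideal.add_mem_iff_right] at hevm
    · exact hevm
    · refine Ideal.sum_mem _ fun i hi => Ideal.mul_mem_right _ _ ?_
      have h3 := hcoeff i
      have h4 : Ideal.span {r} ≤ 𝔪 := (Ideal.span_singleton_le_iff_mem _).2 hr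
      simp at hi
      exact h4 (Ideal.pow_le_self (by omega) h3)
  set zb : QuotSMulTop r M := Submodule.Quotient.mk z with hzb
  have hmemI : ∀ s, s ∈ (⊥ : Submodule R (QuotSMulTop r M)).colon {zb} ↔
      s • z ∈ r • (⊤ : Submodule R M) := fun s => by
    rw [Submodule.mem_colon_singleton, Submodule.mem_bot, hzb, ← Submodule.Quotient.mk_smul,
      Submodule.Quotient.mk_eq_zero]
  obtain ⟨Q, hQ, hQm⟩ := Ideal.exists_minimalPrimes_le
    (show (⊥ : Submodule R (QuotSMulTop r M)).colon {zb} ≤ 𝔪 from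
      fun s hs => hzm s ((hmemI s).1 hs))
  obtain ⟨y, hy⟩ := Submodule.exists_eq_colon_of_mem_minimalPrimes hQ
  have hle := hQ.1.2
  have hPQ : P ≤ Q := fun p hp => hle ((hmemI p).2 (by rw [(hN z).1 hz p hp]; exact zero_mem _))
  have hrQ : r ∈ Q := hle ((hmemI r).2 (Submodule.smul_mem_pointwise_smul _ _ _ trivial))
  exact ⟨Q, hQ.1.1, lt_of_le_of_ne hPQ fun h => hrP (h ▸ hrQ), hQm, y, hy⟩

/-- The length of a weakly regular sequence in `𝔪` is bounded by the coheight of every associated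
prime contained in `𝔪`. -/
theorem length_le_coheight_of_isWeaklyRegular {𝔪 : Ideal R} [𝔪.IsPrime] (rs : List R)
    {M : Type*} [AddCommGroup M] [Module R M] [Module.Finite R M]
    (h : RingTheory.Sequence.IsWeaklyRegular M rs) (hrs : ∀ r ∈ rs, r ∈ 𝔪)
    {P : Ideal R} (hP : P.IsPrime) (hPm : P ≤ 𝔪) {x : M}
    (hx : P = (⊥ : Submodule R M).colon {x}) :
    (rs.length : ℕ∞) ≤ Order.coheight (⟨P, hP⟩ : PrimeSpectrum R) := by
  induction rs generalizing M P with
  | nil => simp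
  | cons r rs ih =>
    rw [RingTheory.Sequence.isWeaklyRegular_cons_iff] at h
    obtain ⟨Q, hQ, hPQ, hQm, y, hy⟩ := exists_associated_prime_gt hP hPm hx
      (hrs r (by simp)) h.1
    have h1 := ih h.2 (fun r hr => hrs r (by simp [hr])) hQ hQm hy
    have h2 : Order.coheight (⟨Q, hQ⟩ : PrimeSpectrum R) + 1 ≤
        Order.coheight (⟨P, hP⟩ : PrimeSpectrum R) := Order.coheight_add_one_le hPQ
    rw [List.length_cons, Nat.cast_add, Nat.cast_one]
    exact (add_le_add_left h1 1).trans h2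

omit [IsNoetherianRing R] in
theorem coheight_eq_ringKrullDim_quotient {P : Ideal R} (hP : P.IsPrime) :
    (Order.coheight (⟨P, hP⟩ : PrimeSpectrum R) : WithBot ℕ∞) = ringKrullDim (R ⧸ P) := by
  rw [Order.coheight_eq_krullDim_Ici, ringKrullDim_quotient]
  rfl

end DepthBound

/-! ### Ideals generated by variables: primality and dimension -/

section VariableIdeals

variable {k : Type*} [Field k] {σ : Type*} (s : Set σ)

open Classical in
/-- The substitution of zero for the variables in `s`. -/
def killVars : MvPolynomial σ k →ₐ[k] MvPolynomial (sᶜ : Set σ) k :=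
  aeval fun i => if h : i ∈ s then 0 else X ⟨i, h⟩

variable {s}

theorem killVars_X_of_mem {i : σ} (h : i ∈ s) : killVars (k := k) s (X i) = 0 := by
  simp [killVars, h]

theorem killVars_X_of_notMem {i : σ} (h : i ∉ s) : killVars (k := k) s (X i) = X ⟨i, h⟩ := by
  simp [killVars, h]

theorem killVars_rename (x : MvPolynomial (sᶜ : Set σ) k) :
    killVars s (rename Subtype.val x) = x := by
  have : (killVars (k := k) s).comp (rename Subtype.val) = AlgHom.id k _ := by
    ext i
    simp [killVars_X_of_notMem i.2]
  exact DFunLike.congr_fun this x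

theorem sub_rename_killVars_mem (x : MvPolynomial σ k) :
    x - rename Subtype.val (killVars s x) ∈
      Ideal.span (X '' s : Set (MvPolynomial σ k)) := by
  rw [← Ideal.Quotient.eq]
  have : Ideal.Quotient.mkₐ k (Ideal.span (X '' s : Set (MvPolynomial σ k))) =
      ((Ideal.Quotient.mkₐ k _).comp (rename Subtype.val)).comp (killVars s) := by
    ext i
    by_cases h : i ∈ s
    · simp only [AlgHom.comp_apply, killVars_X_of_mem h, map_zero]
      exact Ideal.Quotient.eq_zero_iff_mem.2 (Ideal.subset_span ⟨i, h, rfl⟩)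
    · simp [killVars_X_of_notMem h]
  exact DFunLike.congr_fun this x

theorem ker_killVars :
    RingHom.ker (killVars (k := k) s) = Ideal.span (X '' s : Set (MvPolynomial σ k)) := by
  apply le_antisymm
  · intro x hx
    have h := sub_rename_killVars_mem (s := s) x
    rwa [RingHom.mem_ker.1 hx, map_zero, sub_zero] at h
  · rw [Ideal.span_le]
    rintro _ ⟨i, hi, rfl⟩
    exact killVars_X_of_mem hi

theorem isPrime_span_X_image : (Ideal.span (X '' s : Set (MvPolynomial σ k))).IsPrime := by
  rw [← ker_killVars]
  exact RingHom.ker_isPrime _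

theorem ringKrullDim_quotient_span_X_image [Finite σ] :
    ringKrullDim (MvPolynomial σ k ⧸ Ideal.span (X '' s : Set (MvPolynomial σ k))) =
      (sᶜ.ncard : WithBot ℕ∞) := by
  rw [← ker_killVars, ringKrullDim_eq_of_ringEquiv (Ideal.quotientKerAlgEquivOfSurjective
    (f := killVars (k := k) s) fun x => ⟨_, killVars_rename x⟩).toRingEquiv,
    MvPolynomial.ringKrullDim_of_isNoetherianRing, ringKrullDim_eq_zero_of_field, zero_add]
  rfl

end VariableIdeals

/-! ### Dimension and depth of `R / J` -/

section Depth

variable (k : Type*) [Field k] [CharZero k] {n : ℕ}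

variable (n) in
/-- The first `j` variables `x_0, …, x_{j-1}`. -/
def initialVars (j : ℕ) : Set (Fin (n + 1)) := {l | (l : ℕ) < j}

omit [CharZero k] in
theorem sum_mul_mem_mul_gradientIdeal (hn : 1 ≤ n) (I : Ideal (MvPolynomial (Fin (n + 1)) k))
    (c : ℕ → MvPolynomial (Fin (n + 1)) k) (e : MvPolynomial (Fin (n + 1)) k)
    (hc : ∀ p < n, c p ∈ I) (he : e ∈ I) :
    ∑ p ∈ Finset.range n, c p * tailPartial (subdiag k n) (diag k n) n p +
      e * lastPartial (subdiag k n) (diag k n) (n - 1) ∈ I * gradientIdeal k n := by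
  refine add_mem (Ideal.sum_mem _ fun p hp => Ideal.mul_mem_mul (hc p (by simpa using hp)) ?_)
    (Ideal.mul_mem_mul he (lastPartial_mem_gradientIdeal k hn))
  rw [gradientIdeal_eq k hn]
  exact Ideal.mem_sup_left (tailPartial_mem (by simpa using hp))

/-- The gradient ideal is Tor-independent of the ideals `(x_0, …, x_{j-1})`, `j ≤ n - 2`. -/
theorem inf_gradientIdeal_le (hn : 2 ≤ n) {j : ℕ} (hj : j ≤ n - 2) :
    Ideal.span (X '' initialVars n j) ⊓ gradientIdeal k n ≤
      Ideal.span (X '' initialVars n j) * gradientIdeal k n := by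
  set K : Ideal (MvPolynomial (Fin (n + 1)) k) := Ideal.span (X '' initialVars n j) with hK
  set b := subdiag k n
  set a := diag k n
  let ψ : MvPolynomial (Fin (n + 1)) k →ₐ[k] MvPolynomial (Fin (n + 1)) k :=
    (rename Subtype.val).comp (killVars (initialVars n j))
  have hψsub : ∀ x, x - ψ x ∈ K := sub_rename_killVars_mem
  have hψK : ∀ x ∈ K, ψ x = 0 := by
    intro x hx
    rw [hK, ← ker_killVars, RingHom.mem_ker] at hx
    change rename Subtype.val (killVars (initialVars n j) x) = 0
    rw [hx, map_zero]
  have hψψ : ∀ x, ψ (ψ x) = ψ x := fun x =>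
    congrArg (rename Subtype.val) (killVars_rename _)
  have hψX : ∀ l : Fin (n + 1), j ≤ l → ψ (X l) = X l := by
    intro l hl
    change rename Subtype.val (killVars (initialVars n j) (X l)) = X l
    rw [killVars_X_of_notMem (by simpa [initialVars] using hl), rename_X]
  have hψb : ψ b = b := by
    change ψ (-X (Fin.last n)) = -X (Fin.last n)
    rw [map_neg, hψX _ (by simp; omega)]
  -- As `j ≤ n - 2`, the substitution fixes `x_n, x_{n-1}, x_{n-2}`, so the specialised partials
  -- still come from a regular triple.
  have hψa : ∀ i, i ≤ 2 → ψ (a i) = a i := by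
    intro i hi
    simp only [a, diag]
    rw [if_pos (by omega)]
    exact hψX _ (by simp; omega)
  have h0 : ∀ x, ψ b * x = 0 → x = 0 := by
    rw [hψb]
    exact subdiag_mul_eq_zero
  have h1 : ∀ x, ψ (a 1) * x ∈ Ideal.span {ψ b} → x ∈ Ideal.span {ψ b} := by
    rw [hψb, hψa 1 (by omega)]
    exact mem_span_subdiag (by omega)
  have h2 : ∀ x, ψ (a 2) * x ∈ Ideal.span {ψ b, ψ (a 1)} → x ∈ Ideal.span {ψ b, ψ (a 1)} := by
    rw [hψb, hψa 1 (by omega), hψa 2 le_rfl]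
    exact mem_span_subdiag_pair hn
  rintro x ⟨hxK, hxJ⟩
  rw [SetLike.mem_coe, gradientIdeal_eq k (by omega)] at hxJ
  obtain ⟨y, hy, z, hz, rfl⟩ := Submodule.mem_sup.1 hxJ
  obtain ⟨c, rfl⟩ := mem_tailPartialIdeal.1 hy
  obtain ⟨e, rfl⟩ := Ideal.mem_span_singleton'.1 hz
  have hzero := hψK _ hxK
  simp only [map_add, map_sum, map_mul] at hzero
  have hY : ∀ N p, ψ (tailPartial b a N p) = tailPartial (ψ b) (fun i => ψ (a i)) N p :=
    map_tailPartial b a ψ.toRingHom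
  have hG : ∀ m, ψ (lastPartial b a m) = lastPartial (ψ b) (fun i => ψ (a i)) m :=
    map_lastPartial b a ψ.toRingHom
  have hL : ∀ m p, ψ (linearSyzygy b a m p) = linearSyzygy (ψ b) (fun i => ψ (a i)) m p :=
    map_linearSyzygy b a ψ.toRingHom
  have he : ψ e ∈ tailIdeal k n := by
    rw [tailIdeal_eq k (by omega)]
    change ψ e ∈ Ideal.span {b, a 1 ^ (n - 1)}
    rw [← hψb, ← hψa 1 (by omega)]
    obtain ⟨m, rfl⟩ : ∃ m, n = m + 2 := ⟨n - 2, by omega⟩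
    refine mem_span_of_mul_lastPartial_mem (a := fun i => ψ (a i)) h0 h1 isUnit_natCast_succ h2 m
      ?_
    rw [← hG, show m + 1 = m + 2 - 1 by omega, eq_neg_of_add_eq_zero_right hzero]
    refine neg_mem (Ideal.sum_mem _ fun p hp => Ideal.mul_mem_left _ _ ?_)
    rw [hY]
    exact tailPartial_mem (by simpa using hp)
  -- The annihilator `(b, a_1^(n-1))` is the same before and after specialisation, so `ψ e` already
  -- annihilates the original `G` modulo `J_{n-1}`.
  obtain ⟨β, hβ⟩ := mem_tailPartialIdeal.1 ((mul_lastPartial_mem_iff k hn _).2 he)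
  have hβ' := congrArg ψ hβ
  rw [map_mul, hψψ, map_sum] at hβ'
  simp only [map_mul] at hβ'
  obtain ⟨m, rfl⟩ : ∃ m, n = m + 1 := ⟨n - 1, by omega⟩
  obtain ⟨d, hd⟩ := exists_eq_sum_linearSyzygy (a := fun i => ψ (a i)) h0 h1 isUnit_natCast_succ
    (N := m) (fun p => ψ (c p) + ψ (β p)) (by
      simp only [add_mul, Finset.sum_add_distrib, ← hY]
      rw [← hβ', hzero])
  have hsyz : ∑ p ∈ Finset.range (m + 1), (∑ q ∈ Finset.range m, d q * linearSyzygy b a (q + 1) p) *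
      tailPartial b a (m + 1) p = 0 := by
    simp only [Finset.sum_mul, mul_assoc]
    rw [Finset.sum_comm]
    refine Finset.sum_eq_zero fun q hq => ?_
    rw [← Finset.mul_sum, sum_linearSyzygy_eq_zero b a (by simpa using hq), mul_zero]
  -- Subtracting genuine syzygies that lift the specialised relation does not change the element,
  -- but moves all its coefficients into `K`.
  have hfin := sum_mul_mem_mul_gradientIdeal k (by omega) K
    (fun p => c p + β p - ∑ q ∈ Finset.range m, d q * linearSyzygy b a (q + 1) p) (e - ψ e)
    (fun p hp => by
      have h3 := sub_mem (add_mem (hψsub (c p)) (hψsub (β p)))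
        (Ideal.sum_mem K (t := Finset.range m)
          (f := fun q => d q * (linearSyzygy b a (q + 1) p - ψ (linearSyzygy b a (q + 1) p)))
          fun q _ => Ideal.mul_mem_left _ (d q) (hψsub (linearSyzygy b a (q + 1) p)))
      convert h3 using 1
      simp only [mul_sub, Finset.sum_sub_distrib, hL, ← hd p hp]
      ring) (hψsub e)
  convert hfin using 1
  simp only [sub_mul, add_mul, Finset.sum_sub_distrib, Finset.sum_add_distrib]
  rw [hsyz, hβ]
  ring

omit [CharZero k] in
theorem initialVars_succ {j : ℕ} (hj : j < n + 1) :
    Ideal.span (X '' initialVars n (j + 1) : Set (MvPolynomial (Fin (n + 1)) k)) =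
      Ideal.span {X ⟨j, hj⟩} ⊔ Ideal.span (X '' initialVars n j) := by
  rw [← Ideal.span_insert, ← Set.image_insert_eq]
  congr 2
  ext l
  simp [initialVars, Fin.ext_iff]
  omega

/-- Let `K_j = (x_0, …, x_{j-1})`. If `x_j u = κ + x` with `κ ∈ K_j` and `x ∈ J`, then `x ∈ K_{j+1}
∩ J = x_j J + K_j J`, so `x_j (u - w) ∈ K_j` for some `w ∈ J`, and `x_j` is regular modulo `K_j`. -/
theorem mem_sup_gradientIdeal_of_X_mul_mem (hn : 3 ≤ n) {j : ℕ} (hj : j < n - 2)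
    {u : MvPolynomial (Fin (n + 1)) k}
    (hu : X ⟨j, by omega⟩ * u ∈ Ideal.span (X '' initialVars n j) ⊔ gradientIdeal k n) :
    u ∈ Ideal.span (X '' initialVars n j) ⊔ gradientIdeal k n := by
  obtain ⟨κ, hκ, x, hx, hκx⟩ := Submodule.mem_sup.1 hu
  have hsucc := initialVars_succ k (n := n) (j := j) (by omega)
  have hx' : x ∈ Ideal.span (X '' initialVars n (j + 1)) * gradientIdeal k n := by
    refine inf_gradientIdeal_le k (by omega) hj ⟨?_, hx⟩
    rw [SetLike.mem_coe, hsucc, ← eq_sub_iff_add_eq'.2 hκx |>.symm]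
    refine sub_mem (Ideal.mem_sup_left ?_) (Ideal.mem_sup_right hκ)
    exact Ideal.mul_mem_right _ _ (Ideal.mem_span_singleton_self _)
  rw [hsucc, Ideal.sup_mul] at hx'
  obtain ⟨y, hy, z, hz, rfl⟩ := Submodule.mem_sup.1 hx'
  obtain ⟨w, hw, rfl⟩ := Ideal.mem_span_singleton_mul.1 hy
  have h1 : X ⟨j, by omega⟩ * (u - w) ∈
      Ideal.span (X '' initialVars n j : Set (MvPolynomial (Fin (n + 1)) k)) := by
    have : X ⟨j, by omega⟩ * (u - w) = κ + z := by rw [mul_sub, ← hκx]; ring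
    rw [this]
    exact add_mem hκ (Ideal.mul_le_inf hz).1
  have hj' : (⟨j, by omega⟩ : Fin (n + 1)) ∉ initialVars n j := lt_irrefl j
  have h2 := mem_span_X_of_X_mul_mem hj' h1
  rw [← sub_add_cancel u w]
  exact Submodule.add_mem_sup h2 hw

/-- The sequence `x_0, …, x_{n-3}`. -/
def initialSequence (hn : 3 ≤ n) : List (MvPolynomial (Fin (n + 1)) k) :=
  List.ofFn fun j : Fin (n - 2) => X ⟨j, by omega⟩

omit [CharZero k] in
theorem ofList_take_initialSequence (hn : 3 ≤ n) {j : ℕ} (hj : j ≤ n - 2) :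
    Ideal.ofList ((initialSequence k hn).take j) = Ideal.span (X '' initialVars n j) := by
  rw [Ideal.ofList]
  congr 1
  ext x
  simp only [Set.mem_ofPred_eq, List.mem_take_iff_getElem, Set.mem_image, initialSequence,
    List.getElem_ofFn, List.length_ofFn]
  constructor
  · rintro ⟨i, hi, rfl⟩
    exact ⟨⟨i, by omega⟩, show i < j by omega, rfl⟩
  · rintro ⟨l, hl, rfl⟩
    have hl' : (l : ℕ) < j := hl
    exact ⟨l, by omega, rfl⟩

omit [CharZero k] in
theorem mk_mem_smul_top_iff {σ : Type*} {I J : Ideal (MvPolynomial σ k)} (u : MvPolynomial σ k) :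
    (Ideal.Quotient.mk J u : MvPolynomial σ k ⧸ J) ∈
      (I • ⊤ : Submodule (MvPolynomial σ k) (MvPolynomial σ k ⧸ J)) ↔ u ∈ I ⊔ J := by
  have h : (I • ⊤ : Submodule (MvPolynomial σ k) (MvPolynomial σ k ⧸ J)) =
      Submodule.map (Submodule.mkQ J) I := by
    rw [← Submodule.range_mkQ J, ← Submodule.map_top, ← Submodule.map_smul'']
    simp
  rw [h, sup_comm, ← Submodule.comap_map_mkQ J I]
  rfl

theorem gradientIdeal_le_span_pair (hn : 3 ≤ n) :
    gradientIdeal k n ≤ Ideal.span {subdiag k n, diag k n 1} := by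
  rw [gradientIdeal_eq k (by omega), sup_le_iff, Ideal.span_singleton_le_iff_mem]
  exact ⟨tailPartialIdeal_le (by omega) isUnit_natCast_succ,
    lastPartial_mem (by omega) isUnit_natCast_succ⟩

omit [CharZero k] in
theorem irrelevantIdeal_eq (σ : Type*) :
    irrelevantIdeal σ k = Ideal.span (X '' (Set.univ : Set σ)) := by
  rw [irrelevantIdeal, Set.image_univ]

theorem initialSequence_isRegular (hn : 3 ≤ n) :
    RingTheory.Sequence.IsRegular (MvPolynomial (Fin (n + 1)) k ⧸ gradientIdeal k n)
      (initialSequence k hn) := by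
  refine ⟨⟨fun j hj => ?_⟩, fun h => ?_⟩
  · have hj' : j < n - 2 := by simpa [initialSequence] using hj
    rw [isSMulRegular_iff_right_eq_zero_of_smul]
    intro x hx
    obtain ⟨x, rfl⟩ := Submodule.mkQ_surjective _ x
    obtain ⟨u, rfl⟩ := Ideal.Quotient.mk_surjective x
    rw [← map_smul, Submodule.mkQ_apply, Submodule.Quotient.mk_eq_zero] at hx
    rw [Submodule.mkQ_apply, Submodule.Quotient.mk_eq_zero]
    have hx' : (Ideal.Quotient.mk (gradientIdeal k n) (X ⟨j, by omega⟩ * u)) ∈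
        (Ideal.ofList ((initialSequence k hn).take j) • ⊤ : Submodule (MvPolynomial (Fin (n + 1)) k)
          (MvPolynomial (Fin (n + 1)) k ⧸ gradientIdeal k n)) := by
      convert hx using 1
      simp [initialSequence]
      rfl
    rw [mk_mem_smul_top_iff, ofList_take_initialSequence k hn hj'.le] at hx' ⊢
    exact mem_sup_gradientIdeal_of_X_mul_mem k hn hj' hx'
  · have h1 : (Ideal.Quotient.mk (gradientIdeal k n) 1) ∈
        (Ideal.ofList (initialSequence k hn) • ⊤ : Submodule (MvPolynomial (Fin (n + 1)) k)
          (MvPolynomial (Fin (n + 1)) k ⧸ gradientIdeal k n)) := h ▸ trivial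
    rw [mk_mem_smul_top_iff] at h1
    have h2 : Ideal.ofList (initialSequence k hn) ⊔ gradientIdeal k n ≤
        irrelevantIdeal (Fin (n + 1)) k := by
      rw [irrelevantIdeal_eq]
      refine sup_le (Ideal.span_le.2 ?_) ((gradientIdeal_le_span_pair k hn).trans ?_)
      · intro x hx
        obtain ⟨i, rfl⟩ := (List.mem_ofFn' _ _).1 hx
        exact Ideal.subset_span ⟨_, trivial, rfl⟩
      · rw [span_subdiag_pair (by omega)]
        exact Ideal.span_mono (Set.image_mono (Set.subset_univ _))
    have h3 := h2 h1
    rw [irrelevantIdeal_eq] at h3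
    exact isPrime_span_X_image.ne_top ((Ideal.eq_top_iff_one _).2 h3)

theorem exists_socle_eq_colon (hn : 3 ≤ n) :
    ∃ x : MvPolynomial (Fin (n + 1)) k ⧸ gradientIdeal k n,
      Ideal.span {subdiag k n, diag k n 1, diag k n 2} =
        (⊥ : Submodule (MvPolynomial (Fin (n + 1)) k) _).colon {x} := by
  obtain ⟨m, rfl⟩ : ∃ m, n = m + 3 := ⟨n - 3, by omega⟩
  refine ⟨Ideal.Quotient.mk _ ((subdiag k (m + 3) * diag k (m + 3) 2) ^ (m + 1)), ?_⟩
  ext u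
  rw [← mul_socle_mem_iff subdiag_mul_eq_zero (mem_span_subdiag (by omega)) isUnit_natCast_succ
    (mem_span_subdiag_pair (by omega)), Submodule.mem_colon_singleton, Submodule.mem_bot]
  have h := gradientIdeal_eq k (n := m + 3) (by omega)
  rw [show m + 3 - 1 = m + 2 by omega] at h
  rw [← h, ← Ideal.Quotient.eq_zero_iff_mem]
  rfl

theorem ringKrullDim_quotient_gradientIdeal (hn : 3 ≤ n) :
    ringKrullDim (MvPolynomial (Fin (n + 1)) k ⧸ gradientIdeal k n) = ((n - 1 : ℕ) : ℕ∞) := by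
  -- The radical of `J` is `(x_n, x_{n-1})`: the first partial is a power of `b`, and the one of
  -- index `n - 1` is `n a_1^(n-1)` modulo `b`, up to sign.
  have hzero : PrimeSpectrum.zeroLocus (gradientIdeal k n : Set (MvPolynomial (Fin (n + 1)) k)) =
      PrimeSpectrum.zeroLocus (Ideal.span {subdiag k n, diag k n 1} : Ideal _) := by
    refine Set.Subset.antisymm (fun P hP => ?_)
      (PrimeSpectrum.zeroLocus_anti_mono (gradientIdeal_le_span_pair k hn))
    have hP' : gradientIdeal k n ≤ P.asIdeal := hP
    have htail : ∀ p < n, tailPartial (subdiag k n) (diag k n) n p ∈ P.asIdeal := fun p hp =>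
      hP' (by rw [gradientIdeal_eq k (by omega)]; exact Ideal.mem_sup_left (tailPartial_mem hp))
    have hb : subdiag k n ∈ P.asIdeal := by
      have h1 := htail 0 (by omega)
      rw [tailPartial, hessenbergSq_zero, mul_one] at h1
      exact P.2.mem_of_pow_mem _ h1
    have ha : diag k n 1 ∈ P.asIdeal := by
      have h1 := htail (n - 1) (by omega)
      rw [tailPartial, Nat.sub_self, pow_zero, one_mul] at h1
      have h2 := (Ideal.span_singleton_le_iff_mem P.asIdeal).2 hb
        (hessenbergSq_sub_mem (b := subdiag k n) (a := diag k n) (n - 1) isUnit_natCast_succ)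
      have h3 := sub_mem h1 h2
      rw [sub_sub_cancel, Ideal.unit_mul_mem_iff_mem _ (isUnit_natCast_succ _)] at h3
      exact P.2.mem_of_pow_mem _ h3
    change Ideal.span {subdiag k n, diag k n 1} ≤ P.asIdeal
    rw [Ideal.span_le]
    rintro x (rfl | rfl)
    · exact hb
    · exact ha
  rw [ringKrullDim_quotient, hzero, ← ringKrullDim_quotient, span_subdiag_pair (by omega),
    ringKrullDim_quotient_span_X_image]
  congr 2
  have h := Set.ncard_add_ncard_compl
    ({Fin.last n, ⟨n - 1, by omega⟩} : Set (Fin (n + 1)))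
  rw [Set.ncard_pair (by simp [Fin.ext_iff]; omega), Nat.card_fin] at h
  omega

omit [CharZero k] in
theorem ringKrullDim_quotient_span_triple (hn : 2 ≤ n) :
    ringKrullDim (MvPolynomial (Fin (n + 1)) k ⧸
      Ideal.span {subdiag k n, diag k n 1, diag k n 2}) = ((n - 2 : ℕ) : ℕ∞) := by
  rw [span_subdiag_triple hn, ringKrullDim_quotient_span_X_image]
  congr 2
  have h := Set.ncard_add_ncard_compl
    ({Fin.last n, ⟨n - 1, by omega⟩, ⟨n - 2, by omega⟩} : Set (Fin (n + 1)))
  rw [Set.ncard_insert_of_notMem (by simp [Fin.ext_iff]; omega),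
    Set.ncard_pair (by simp [Fin.ext_iff]; omega), Nat.card_fin] at h
  omega

theorem depth_quotient_gradientIdeal (hn : 3 ≤ n) :
    depth (Fin (n + 1)) k (MvPolynomial (Fin (n + 1)) k ⧸ gradientIdeal k n) = (n - 2 : ℕ) := by
  apply le_antisymm
  · refine iSup₂_le fun rs hrs => ?_
    obtain ⟨x, hx⟩ := exists_socle_eq_colon k hn
    have hmax : (irrelevantIdeal (Fin (n + 1)) k).IsPrime := by
      rw [irrelevantIdeal_eq]
      exact isPrime_span_X_image
    have hP : (Ideal.span {subdiag k n, diag k n 1, diag k n 2}).IsPrime := by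
      rw [span_subdiag_triple (by omega)]
      exact isPrime_span_X_image
    have hPm : Ideal.span {subdiag k n, diag k n 1, diag k n 2} ≤
        irrelevantIdeal (Fin (n + 1)) k := by
      rw [span_subdiag_triple (by omega), irrelevantIdeal_eq]
      exact Ideal.span_mono (Set.image_mono (Set.subset_univ _))
    have h1 := length_le_coheight_of_isWeaklyRegular rs hrs.2.1 hrs.1 hP hPm hx
    have h2 := coheight_eq_ringKrullDim_quotient hP
    rw [ringKrullDim_quotient_span_triple k (by omega)] at h2
    rw [← WithBot.coe_injective h2]
    exact h1
  · refine le_trans ?_ (le_iSup₂ (initialSequence k hn) ⟨?_, initialSequence_isRegular k hn⟩)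
    · simp [initialSequence]
    · intro r hr
      obtain ⟨i, rfl⟩ := (List.mem_ofFn' _ _).1 hr
      exact Ideal.subset_span ⟨_, rfl⟩

theorem isStrictlyAlmostCohenMacaulay_gradientIdeal (hn : 3 ≤ n) :
    IsStrictlyAlmostCohenMacaulay (gradientIdeal k n) := by
  rw [IsStrictlyAlmostCohenMacaulay, ringKrullDim_quotient_gradientIdeal k hn,
    depth_quotient_gradientIdeal k hn, show n - 1 = n - 2 + 1 by omega]
  rfl

end Depth

end SubHankel

end

theorem mainTheorem5 (k : Type*) [Field k] [CharZero k] (n : ℕ) (hn : 2 ≤ n) :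
    -- the graded isomorphism `(R ⧸ (x_n, x_{n-1}^{n-1}))(-(n-1)) ≃ J / J_{n-1}`
    (∃ e : (MvPolynomial (Fin (n + 1)) k ⧸ SubHankel.tailIdeal k n)
        ≃ₗ[MvPolynomial (Fin (n + 1)) k] SubHankel.gradientQuotient k n,
      ∀ j x, x ∈ SubHankel.shiftGrading
          (SubHankel.quotientGrading (SubHankel.tailIdeal k n)) (n - 1) j ↔
        e x ∈ SubHankel.submoduleGrading (SubHankel.gradientQuotient k n) j) ∧
    -- resolutions `C` of `J / J_{n-1}` and `F` of `R ⧸ J_{n-1}`, and a lift `g : C → F` of the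
    -- inclusion `J / J_{n-1} ⊆ R ⧸ J_{n-1}`
    (∃ (C F : SubHankel.GradedFreeComplex k (Fin (n + 1)))
        (εC : (C.ι 0 → MvPolynomial (Fin (n + 1)) k)
          →ₗ[MvPolynomial (Fin (n + 1)) k] SubHankel.gradientQuotient k n)
        (εF : (F.ι 0 → MvPolynomial (Fin (n + 1)) k) →ₗ[MvPolynomial (Fin (n + 1)) k]
          (MvPolynomial (Fin (n + 1)) k ⧸ SubHankel.subgradientIdeal k n))
        (g : SubHankel.GradedFreeComplex.Hom C F),
      C.IsMinimalResolution (SubHankel.submoduleGrading (SubHankel.gradientQuotient k n)) εC ∧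
      C.twists 0 = {n - 1} ∧ C.twists 1 = {n, 2 * (n - 1)} ∧ C.twists 2 = {2 * n - 1} ∧
      (∀ i, 3 ≤ i → C.twists i = 0) ∧
      F.IsMinimalResolution (SubHankel.quotientGrading (SubHankel.subgradientIdeal k n)) εF ∧
      F.twists 0 = {0} ∧ F.twists 1 = Multiset.replicate n (n - 1) ∧
      F.twists 2 = Multiset.replicate (n - 1) n ∧ (∀ i, 3 ≤ i → F.twists i = 0) ∧
      (∀ v, εF (g.f 0 v) = (εC v : MvPolynomial (Fin (n + 1)) k ⧸ SubHankel.subgradientIdeal k n)) ∧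
      -- the mapping cone of `g` is the minimal graded free resolution of `R ⧸ J`
      g.cone.IsMinimalResolution (SubHankel.quotientGrading (SubHankel.gradientIdeal k n))
        (SubHankel.projection k n ∘ₗ εF) ∧
      g.cone.twists 0 = {0} ∧
      g.cone.twists 1 = Multiset.replicate (n + 1) (n - 1) ∧
      g.cone.twists 2 = Multiset.replicate n n + {2 * (n - 1)} ∧
      g.cone.twists 3 = {2 * n - 1} ∧
      (∀ i, 4 ≤ i → g.cone.twists i = 0) ∧
      -- maximal linear rank
      g.cone.linearRank (n - 1) = n ∧ g.cone.presentationRank = n) ∧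
    (3 ≤ n → SubHankel.IsStrictlyAlmostCohenMacaulay (SubHankel.gradientIdeal k n)) := by
  refine ⟨⟨SubHankel.tailQuotientEquiv k hn,
    SubHankel.mem_shiftGrading_iff_tailQuotientEquiv_mem hn⟩, ?_,
    SubHankel.isStrictlyAlmostCohenMacaulay_gradientIdeal k⟩
  have hn1 : 1 ≤ n := by omega
  obtain ⟨g, hg⟩ := SubHankel.exists_lift k hn
  refine ⟨SubHankel.koszulComplex k hn1, SubHankel.hilbertBurchComplex k n,
    SubHankel.koszulAug k hn1, SubHankel.hilbertBurchAug k n, g,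
    SubHankel.koszulComplex_isMinimalResolution k hn, SubHankel.koszulComplex_twists_zero k hn1,
    SubHankel.koszulComplex_twists_one k hn1, SubHankel.koszulComplex_twists_two k hn1,
    SubHankel.koszulComplex_twists_of_le k hn1,
    SubHankel.hilbertBurchComplex_isMinimalResolution k hn,
    SubHankel.hilbertBurchComplex_twists_zero k, SubHankel.hilbertBurchComplex_twists_one k,
    SubHankel.hilbertBurchComplex_twists_two k, SubHankel.hilbertBurchComplex_twists_of_le k,
    SubHankel.hilbertBurchAug_lift k hn1 g hg, SubHankel.cone_isMinimalResolution k hn g hg,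
    SubHankel.hilbertBurchComplex_twists_zero k (n := n), ?_, ?_, ?_, ?_, ?_, ?_⟩
  · rw [g.cone_twists_succ, SubHankel.hilbertBurchComplex_twists_one,
      SubHankel.koszulComplex_twists_zero, Multiset.replicate_add, Multiset.replicate_one]
  · rw [g.cone_twists_succ, SubHankel.hilbertBurchComplex_twists_two,
      SubHankel.koszulComplex_twists_one, Multiset.insert_eq_cons, ← Multiset.singleton_add,
      ← add_assoc, ← Multiset.replicate_one, ← Multiset.replicate_add, Nat.sub_add_cancel hn1]
  · rw [g.cone_twists_succ, SubHankel.hilbertBurchComplex_twists_of_le k 3 le_rfl,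
      SubHankel.koszulComplex_twists_two, zero_add]
  · intro i hi
    obtain ⟨i, rfl⟩ := Nat.exists_eq_add_of_le' hi
    rw [show i + 4 = i + 3 + 1 from rfl, g.cone_twists_succ,
      SubHankel.hilbertBurchComplex_twists_of_le k _ (by omega),
      SubHankel.koszulComplex_twists_of_le k hn1 _ (by omega), zero_add]
  · exact le_antisymm ((SubHankel.linearRank_cone_le k hn1 g _).trans
      (SubHankel.presentationRank_cone_le k hn1 g)) (SubHankel.le_linearRank_cone k hn1 g)
  · exact le_antisymm (SubHankel.presentationRank_cone_le k hn1 g)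
      ((SubHankel.le_linearRank_cone k hn1 g).trans (SubHankel.linearRank_cone_le k hn1 g _))
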